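/- A plane partition is a finite set $P$ of points $(i,j,k)$ with positive integer coordinates (the midpoints of unit cubes) such that if $(i,j,k)\in P$ and $1\le i'\le i$, $1\le j'\le j$, $1\le k'\le k$, then $(i',j',k')\in P$. It is contained in the box $a\times a\times c$ if $i,j\le a$ and $k\le c$ for all $(i,j,k)\in P$. A plane partition $P$ contained in the box $a\times a\times c$ is called transpose-complementary if for all $1\le i,j\le a$ and $1\le k\le c$ exactly one of the two statements $(i,j,k)\in P$ and $(a+1-j,\,a+1-i,\,c+1-k)\in P$ holds. **Theorem (Kuperberg).** Let $a\ge 1$ and $b\ge 0$ be integers. For a transpose-complementary plane partition $P$ contained in the box $a\times a\times 2b$, let $n(P)$ be the number of cubes of $P$ in the upper half of the box, that is, the number of $(i,j,k)\in P$ with $k>b$. Then $$\sum_{P}(-1)^{n(P)}=\begin{cases}0&\text{if } b \text{ is odd and } a \text{ is even},\\[4pt] \displaystyle\prod_{j=1}^{\lceil a/2\rceil-1}\frac{\left(\lfloor b/2\rfloor+j\right)(a-j)_b}{(j)_{b+1}}&\text{otherwise},\end{cases}$$ where the sum runs over all transpose-complementary plane partitions $P$ contained in the box $a\times a\times 2b$,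 $(x)_n=x(x+1)\cdots(x+n-1)$ denotes the shifted factorial (with $(x)_0=1$), and an empty product is $1$. -/

import Mathlib

open Finset

/-- A finite set of points `(i, j, k)` (cubes) with positive coordinates is a plane partition if
with each point it contains all points with positive and componentwise smaller or equal
coordinates. -/
def IsPlanePartition (P : Finset (ℕ × ℕ × ℕ)) : Prop :=
  (∀ i j k : ℕ, (i, j, k) ∈ P → 0 < i ∧ 0 < j ∧ 0 < k) ∧
  ∀ i j k i' j' k' : ℕ, (i, j, k) ∈ P →
    1 ≤ i' → i' ≤ i → 1 ≤ j' → j' ≤ j → 1 ≤ k' → k' ≤ k → (i', j', k') ∈ P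

/-- The points of the box with sidelengths `a`, `b`, `c`. -/
def box (a b c : ℕ) : Finset (ℕ × ℕ × ℕ) :=
  Icc 1 a ×ˢ Icc 1 b ×ˢ Icc 1 c

/-- A subset of the `a × a × c` box is transpose-complementary if it contains exactly one of any
two points `(i, j, k)` and `(a + 1 - j, a + 1 - i, c + 1 - k)` of the box.
No subtraction truncates here, since `i, j ≤ a` and `k ≤ c`. -/
def IsTransposeComplementary (a c : ℕ) (P : Finset (ℕ × ℕ × ℕ)) : Prop :=
  ∀ i ∈ Icc 1 a, ∀ j ∈ Icc 1 a, ∀ k ∈ Icc 1 c,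
    ((i, j, k) ∈ P ↔ (a + 1 - j, a + 1 - i, c + 1 - k) ∉ P)

open Classical in
/-- The set of all transpose-complementary plane partitions contained in the `a × a × c` box. -/
noncomputable def tcPlanePartitions (a c : ℕ) : Finset (Finset (ℕ × ℕ × ℕ)) :=
  {P ∈ (box a a c).powerset | IsPlanePartition P ∧ IsTransposeComplementary a c P}

/-- The number `n(P)` of cubes of `P` in the upper half of a box of height `2 * b`. -/
def upperCubes (b : ℕ) (P : Finset (ℕ × ℕ × ℕ)) : ℕ :=
  #{p ∈ P | b < p.2.2}

/-- The shifted factorial `(x)_n = x (x + 1) ⋯ (x + n - 1)`. -/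
noncomputable def shiftedFactorial (x : ℚ) (n : ℕ) : ℚ :=
  (ascPochhammer ℚ n).eval x

/-! Every cube in the upper half satisfies i + j ≤ a, and complementation determines the lower half
from the upper one. The cube counts on the diagonals of an upper layer trace a ±1 path of length 2a.
The b layers together form nonintersecting nonnegative paths that start and end at heights 0, 2, 4,
…. Giving each visited height x the sign (-1)^⌊x/2⌋ reproduces (-1)^n(P) up to a global sign
(`neg_one_pow_upperCubes`).

A Lindström–Gessel–Viennot argument (`signedChainSum_eq_det`) turns the signed count into a b × b
minor of a power of the one-particle transfer operator. On even heights, two steps form a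
tridiagonal operator with diagonal 1, 0, 0, … (`transfer_transfer`). By means of its orthogonal
polynomials, the leading minor of its a-th power becomes, up to sign, the Hankel determinant of its
moments from index a on (`det_jacobi_pow`). From index 1 on, these moments are signed Catalan
numbers alternating with zeros.

The zeros give the Hankel matrix a checkerboard pattern. For odd a it splits into two Catalan Hankel
determinants; for even a and b its determinant is the square of one, up to sign; for even a and odd
b it is singular. Dodgson condensation evaluates the Catalan determinants
(`hankelDet_signedCatalan`), and an induction matches them with the stated product. -/

/-! ### Minors of powers of tridiagonal operators as Hankel determinants. -/

/-- The functional `p ↦ L p` applied to `Q i * X ^ m * Q j` for monic polynomials `Q i` of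
degree `i` has the same determinant as the Hankel matrix of its moments. -/
theorem det_apply_mul_X_pow_mul {n : ℕ} (L : Polynomial ℤ →ₗ[ℤ] ℤ) (Q : ℕ → Polynomial ℤ)
    (hdeg : ∀ i, (Q i).natDegree = i) (hmonic : ∀ i, (Q i).Monic) (m : ℕ) :
    (Matrix.of fun i j : Fin n => L (Q i * Polynomial.X ^ m * Q j)).det =
      (Matrix.of fun i j : Fin n => L (Polynomial.X ^ (m + i + j))).det := by
  set U : Matrix (Fin n) (Fin n) ℤ := Matrix.of fun i j => (Q j).coeff i with hU
  have hUdet : U.det = 1 := by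
    have := Matrix.det_matrixOfPolynomials (fun i : Fin n => Q i) (fun i => by simp [hdeg])
      (fun i => hmonic i)
    simpa [hU] using this
  have hexp : ∀ j : Fin n, Q j = ∑ l : Fin n, (Q j).coeff l • (Polynomial.X ^ (l : ℕ) :
      Polynomial ℤ) := by
    intro j
    conv_lhs => rw [(Q j).as_sum_range_C_mul_X_pow' (n := n) (by rw [hdeg]; exact j.2)]
    rw [← Fin.sum_univ_eq_sum_range fun l => Polynomial.C ((Q j).coeff l) * Polynomial.X ^ l]
    simp [Polynomial.smul_eq_C_mul]
  have key : (Matrix.of fun i j : Fin n => L (Q i * Polynomial.X ^ m * Q j)) =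
      U.transpose * (Matrix.of fun i j : Fin n => L (Polynomial.X ^ (m + i + j))) * U := by
    ext i j
    rw [Matrix.of_apply, hexp i, hexp j]
    simp only [Matrix.mul_apply, Matrix.transpose_apply, Matrix.of_apply, hU]
    simp only [Finset.sum_mul, Finset.mul_sum, map_sum, smul_mul_assoc, mul_smul_comm, map_smul,
      smul_eq_mul]
    refine Finset.sum_congr rfl fun x _ => Finset.sum_congr rfl fun y _ => ?_
    rw [show (Polynomial.X : Polynomial ℤ) ^ (y : ℕ) * Polynomial.X ^ m * Polynomial.X ^ (x : ℕ) =
      Polynomial.X ^ (m + y + x) by ring]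
    ring
  rw [key, Matrix.det_mul, Matrix.det_mul, Matrix.det_transpose, hUdet]
  ring

/-- The tridiagonal operator with diagonal `α`, superdiagonal `ε` and subdiagonal `1` on
sequences. -/
def jacobi (ε : ℤ) (α : ℕ → ℤ) : Module.End ℤ (ℕ → ℤ) where
  toFun φ i := α i * φ i + ε * φ (i + 1) + (if i = 0 then 0 else φ (i - 1))
  map_add' φ ψ := by
    ext i
    simp only [Pi.add_apply]
    split_ifs <;> ring
  map_smul' c φ := by
    ext i
    simp only [Pi.smul_apply, smul_eq_mul, RingHom.id_apply]
    split_ifs <;> ring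

theorem jacobi_apply (ε : ℤ) (α : ℕ → ℤ) (φ : ℕ → ℤ) (i : ℕ) :
    jacobi ε α φ i = α i * φ i + ε * φ (i + 1) + (if i = 0 then 0 else φ (i - 1)) := rfl

@[simp] theorem jacobi_apply_zero (ε : ℤ) (α : ℕ → ℤ) (φ : ℕ → ℤ) :
    jacobi ε α φ 0 = α 0 * φ 0 + ε * φ 1 := by simp [jacobi_apply]

@[simp] theorem jacobi_apply_succ (ε : ℤ) (α : ℕ → ℤ) (φ : ℕ → ℤ) (i : ℕ) :
    jacobi ε α φ (i + 1) = α (i + 1) * φ (i + 1) + ε * φ (i + 2) + φ i := by simp [jacobi_apply]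

/-- The moments of a tridiagonal operator: the top left entries of its powers. -/
def moment (ε : ℤ) (α : ℕ → ℤ) (m : ℕ) : ℤ := (jacobi ε α ^ m) (Pi.single 0 1) 0

/-- The monic orthogonal polynomials of a tridiagonal operator. -/
noncomputable def orthPoly (ε : ℤ) (α : ℕ → ℤ) : ℕ → Polynomial ℤ
  | 0 => 1
  | 1 => Polynomial.X - Polynomial.C (α 0)
  | i + 2 => (Polynomial.X - Polynomial.C (α (i + 1))) * orthPoly ε α (i + 1)
      - Polynomial.C ε * orthPoly ε α i

theorem orthPoly_monic_natDegree (ε : ℤ) (α : ℕ → ℤ) (i : ℕ) :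
    (orthPoly ε α i).Monic ∧ (orthPoly ε α i).natDegree = i := by
  induction i using Nat.strong_induction_on with
  | _ i ih =>
    match i with
    | 0 => simp [orthPoly]
    | 1 => exact ⟨Polynomial.monic_X_sub_C _, Polynomial.natDegree_X_sub_C _⟩
    | i + 2 =>
      obtain ⟨h1, h2⟩ := ih (i + 1) (by omega)
      obtain ⟨h3, h4⟩ := ih i (by omega)
      have hm := (Polynomial.monic_X_sub_C (α (i + 1))).mul h1
      have hd : ((Polynomial.X - Polynomial.C (α (i + 1))) * orthPoly ε α (i + 1)).natDegree
          = i + 2 := by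
        rw [(Polynomial.monic_X_sub_C (α (i + 1))).natDegree_mul h1, h2,
          Polynomial.natDegree_X_sub_C]
        ring
      have hlt : (Polynomial.C ε * orthPoly ε α i).natDegree < i + 2 :=
        lt_of_le_of_lt (Polynomial.natDegree_C_mul_le _ _) (by omega)
      have hdeg : (Polynomial.C ε * orthPoly ε α i).degree <
          ((Polynomial.X - Polynomial.C (α (i + 1))) * orthPoly ε α (i + 1)).degree :=
        Polynomial.degree_lt_degree (by rw [hd]; exact hlt)
      refine ⟨hm.sub_of_left hdeg, ?_⟩
      rw [orthPoly, Polynomial.natDegree_sub_eq_left_of_natDegree_lt (by rw [hd]; exact hlt), hd]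

/-- The operator sends e_j to e_{j+1} + α_j e_j + ε e_{j-1}, which is exactly the three-term
recurrence. -/
theorem aeval_orthPoly_single (ε : ℤ) (α : ℕ → ℤ) (j : ℕ) :
    Polynomial.aeval (jacobi ε α) (orthPoly ε α j) (Pi.single 0 1) = Pi.single j 1 := by
  induction j using Nat.strong_induction_on with
  | _ j ih =>
    match j with
    | 0 => simp [orthPoly]
    | 1 =>
      ext i
      rcases i with _ | _ | i <;>
        simp [orthPoly, jacobi_apply]
    | j + 2 =>
      rw [orthPoly, map_sub, map_mul, map_mul, LinearMap.sub_apply, Module.End.mul_apply,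
        Module.End.mul_apply, ih (j + 1) (by omega), ih j (by omega)]
      ext i
      rcases i with _ | i
      · rcases j with _ | j <;> simp
      · simp only [map_sub, Polynomial.aeval_X, Polynomial.aeval_C, LinearMap.sub_apply,
          Pi.sub_apply, jacobi_apply_succ, Module.algebraMap_end_apply, Pi.smul_apply,
          smul_eq_mul, Pi.single_apply]
        split_ifs <;> first | omega | (simp; done) | grind

/-- Dual to the previous lemma: the same recurrence read along rows, where each move up the
superdiagonal costs a factor ε. -/
theorem aeval_orthPoly_apply_zero (ε : ℤ) (α : ℕ → ℤ) (i : ℕ) (φ : ℕ → ℤ) :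
    Polynomial.aeval (jacobi ε α) (orthPoly ε α i) φ 0 = ε ^ i * φ i := by
  induction i using Nat.strong_induction_on generalizing φ with
  | _ i ih =>
    match i with
    | 0 => simp [orthPoly]
    | 1 => simp [orthPoly]
    | i + 2 =>
      -- The linear factor must act on `φ` first, so that the induction hypothesis applies to the
      -- resulting sequence.
      rw [orthPoly, mul_comm (Polynomial.X - _), map_sub, map_mul, map_mul, LinearMap.sub_apply,
        Module.End.mul_apply, Module.End.mul_apply, Pi.sub_apply, ih (i + 1) (by omega)]
      simp only [Polynomial.aeval_C, Module.algebraMap_end_apply, Pi.smul_apply, map_sub,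
        Polynomial.aeval_X, LinearMap.sub_apply, Pi.sub_apply, jacobi_apply_succ, smul_eq_mul]
      rw [ih i (by omega)]
      have : ε ^ (i + 1) = ε * ε ^ i := by ring
      rw [this, show ε ^ (i + 2) = ε * ε * ε ^ i by ring]
      ring

/-- The leading minors of powers of a tridiagonal operator are Hankel determinants of its
moments. -/
theorem det_jacobi_pow (ε : ℤ) (α : ℕ → ℤ) (n m : ℕ) :
    (∏ i : Fin n, ε ^ (i : ℕ)) *
      (Matrix.of fun i j : Fin n => (jacobi ε α ^ m) (Pi.single (j : ℕ) 1) i).det =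
      (Matrix.of fun i j : Fin n => moment ε α (m + i + j)).det := by
  let L : Polynomial ℤ →ₗ[ℤ] ℤ :=
    { toFun := fun p => Polynomial.aeval (jacobi ε α) p (Pi.single 0 1) 0
      map_add' := fun p q => by simp
      map_smul' := fun c p => by simp }
  have hL : ∀ p, L p = Polynomial.aeval (jacobi ε α) p (Pi.single 0 1) 0 := fun _ => rfl
  have h := det_apply_mul_X_pow_mul (n := n) L (orthPoly ε α)
    (fun i => (orthPoly_monic_natDegree ε α i).2) (fun i => (orthPoly_monic_natDegree ε α i).1) m
  simp only [hL, map_pow, Polynomial.aeval_X] at h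
  rw [← Matrix.det_mul_column]
  simp only [moment, ← h]
  congr 1
  ext i j
  rw [Matrix.of_apply, Matrix.of_apply, Matrix.of_apply, map_mul, map_mul, Module.End.mul_apply,
    Module.End.mul_apply, aeval_orthPoly_single, aeval_orthPoly_apply_zero, map_pow, Polynomial.aeval_X]

/-! ### The moments: signed Catalan numbers and zeros. -/

theorem semiconj_pow_apply {R M : Type*} [Semiring R] [AddCommMonoid M] [Module R M]
    {K K' : Module.End R M} {T : M → M} (h : ∀ φ, T (K φ) = K' (T φ)) (m : ℕ) (φ : M) :
    T ((K ^ m) φ) = (K' ^ m) (T φ) := by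
  induction m generalizing φ with
  | zero => simp
  | succ m ih => rw [pow_succ, pow_succ, Module.End.mul_apply, Module.End.mul_apply, ih, h]

/-- The map φ_i ↦ φ_i + φ_{i-1} intertwines the two operators and sends e₀ to the image of e₀ under
the one with corner 1; this absorbs one power. -/
theorem moment_succ_of_single (m : ℕ) :
    moment (-1) (Pi.single 0 1) (m + 1) = moment (-1) 0 m := by
  have h := semiconj_pow_apply (K := jacobi (-1) 0) (K' := jacobi (-1) (Pi.single 0 1))
    (T := fun φ i => φ i + if i = 0 then 0 else φ (i - 1)) (fun φ => by
      ext i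
      rcases i with _ | _ | i <;> simp <;> ring) m (Pi.single 0 1)
  have h1 : jacobi (-1) (Pi.single 0 1) (Pi.single 0 1) =
      (fun i : ℕ => (Pi.single 0 1 : ℕ → ℤ) i + if i = 0 then 0 else
        (Pi.single 0 1 : ℕ → ℤ) (i - 1)) := by
    ext i
    rcases i with _ | _ | i <;> simp
  rw [moment, pow_succ, Module.End.mul_apply, h1, ← h]
  simp [moment]

theorem jacobi_zero_pow_eq_zero (m i : ℕ) (h : Odd (m + i)) :
    (jacobi (-1) 0 ^ m) (Pi.single 0 1) i = 0 := by
  induction m generalizing i with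
  | zero =>
    have : i ≠ 0 := by rintro rfl; simp at h
    simp [this]
  | succ m ih =>
    rw [pow_succ', Module.End.mul_apply]
    have h1 := ih (i + 1) (by convert h using 1; ring)
    rcases i with _ | i
    · simp [h1]
    · have h2 := ih i (by rw [Nat.odd_iff] at *; omega)
      simp [h1, h2]

theorem moment_zero_of_odd {m : ℕ} (h : Odd m) : moment (-1) 0 m = 0 :=
  jacobi_zero_pow_eq_zero m 0 h

/-- The signed Catalan numbers `(-1) ^ m * catalan m`. -/
def signedCatalan (m : ℕ) : ℤ := moment 1 (fun i => if i = 0 then -1 else -2) m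

/-- On even positions, the square of the zero-diagonal operator is again tridiagonal, with diagonal
-1, -2, -2, …. -/
theorem moment_zero_two_mul (m : ℕ) : moment (-1) 0 (2 * m) = signedCatalan m := by
  have h := semiconj_pow_apply (K := jacobi (-1) 0 ^ 2)
    (K' := jacobi 1 (fun i => if i = 0 then -1 else -2))
    (T := fun φ i => φ (2 * i)) (fun φ => by
      ext i
      rcases i with _ | i
      · simp [pow_two]
      · simp [pow_two, mul_add]; ring) m (Pi.single 0 1)
  have h1 : (fun i : ℕ => (Pi.single 0 1 : ℕ → ℤ) (2 * i)) = Pi.single 0 1 := by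
    ext i
    simp [Pi.single_apply]
  rw [h1, ← pow_mul] at h
  exact congrFun h 0

/-- The difference map φ_i ↦ φ_i - φ_{i-1} removes the exceptional corner -1, at the cost of one
power and a sign. -/
theorem signedCatalan_succ (m : ℕ) : signedCatalan (m + 1) = -moment 1 (fun _ => -2) m := by
  have h := semiconj_pow_apply (K := jacobi 1 (fun _ => -2))
    (K' := jacobi 1 (fun i => if i = 0 then -1 else -2))
    (T := fun φ i => φ i - if i = 0 then 0 else φ (i - 1)) (fun φ => by
      ext i
      rcases i with _ | _ | i <;> simp <;> ring) m (Pi.single 0 1)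
  have h1 : jacobi 1 (fun i => if i = 0 then -1 else -2) (Pi.single 0 1) =
      -(fun i : ℕ => (Pi.single 0 1 : ℕ → ℤ) i - if i = 0 then 0 else
        (Pi.single 0 1 : ℕ → ℤ) (i - 1)) := by
    ext i
    rcases i with _ | _ | i <;> simp
  rw [signedCatalan, moment, pow_succ, Module.End.mul_apply, h1, map_neg, ← h]
  simp [moment]

/-! ### Hankel determinants and Dodgson condensation. -/

/-- The Hankel determinant of order `k` of the sequence `f` shifted by `m`. -/
def hankelDet {R : Type*} [CommRing R] (f : ℕ → R) (m k : ℕ) : R :=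
  (Matrix.of fun i j : Fin k => f (m + i + j)).det

/-- The zeroth power is the identity. This seeds the condensation recursion at shift 0 and, after
`signedCatalan_succ`, at shift 1. -/
theorem hankelDet_moment_zero (α : ℕ → ℤ) (k : ℕ) : hankelDet (moment 1 α) 0 k = 1 := by
  rw [hankelDet, ← det_jacobi_pow]
  simp only [one_pow, Finset.prod_const_one, one_mul, pow_zero, Module.End.one_apply]
  convert Matrix.det_one (n := Fin k) (R := ℤ) using 2
  ext i j
  simp [Matrix.one_apply, Pi.single_apply, Fin.ext_iff]

theorem hankelDet_signedCatalan_zero (k : ℕ) : hankelDet signedCatalan 0 k = 1 :=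
  hankelDet_moment_zero _ k

theorem hankelDet_signedCatalan_one (k : ℕ) : hankelDet signedCatalan 1 k = (-1) ^ k := by
  have h := hankelDet_moment_zero (fun _ => -2) k
  have : (Matrix.of fun i j : Fin k => signedCatalan (1 + i + j)) =
      -(Matrix.of fun i j : Fin k => moment 1 (fun _ => -2) (0 + i + j)) := by
    ext i j
    rw [Matrix.of_apply, Matrix.neg_apply, Matrix.of_apply, ← signedCatalan_succ]
    congr 1
    ring
  rw [hankelDet, this, Matrix.det_neg, Fintype.card_fin, ← hankelDet, h, mul_one]

theorem det_border {K n : Type*} [Field K] [Fintype n] [DecidableEq n] (N : Matrix n n K)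
    (hN : N.det ≠ 0) (u v : n → K) (d : K) :
    (Matrix.fromBlocks N (Matrix.of fun i (_ : Unit) => u i) (Matrix.of fun (_ : Unit) j => v j)
      (Matrix.of fun _ _ => d)).det = N.det * (d - v ⬝ᵥ (N⁻¹.mulVec u)) := by
  have : Invertible N := Matrix.invertibleOfIsUnitDet N (isUnit_iff_ne_zero.2 hN)
  rw [Matrix.det_fromBlocks₁₁, Matrix.invOf_eq_nonsing_inv, Matrix.mul_assoc,
    Matrix.det_unique (n := Unit)]
  rfl

/-- Dodgson condensation for Hankel determinants. -/
theorem hankelDet_condensation {K : Type*} [Field K] [LinearOrder K] [IsStrictOrderedRing K]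
    (f : ℕ → K) (m n : ℕ) (h : hankelDet f (m + 2) n ≠ 0) :
    hankelDet f m (n + 1) * hankelDet f (m + 2) (n + 1) =
      hankelDet f m (n + 2) * hankelDet f (m + 2) n + hankelDet f (m + 1) (n + 1) ^ 2 := by
  set N : Matrix (Fin n) (Fin n) K := Matrix.of fun i j => f (m + 2 + i + j) with hN
  have hdet : N.det ≠ 0 := h
  have hT : N.transpose = N := by
    ext i j
    simp only [hN, Matrix.transpose_apply, Matrix.of_apply]
    congr 1
    ring
  let e₀ : Fin n ⊕ Unit ≃ Fin (n + 1) := Equiv.ofBijective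
    (Sum.elim Fin.succ fun _ => 0) (by
      constructor
      · rintro (x | x) (y | y) hxy <;> simp [Fin.ext_iff] at hxy ⊢ <;> omega
      · intro y
        rcases Fin.eq_zero_or_eq_succ y with rfl | ⟨x, rfl⟩
        · exact ⟨Sum.inr (), rfl⟩
        · exact ⟨Sum.inl x, rfl⟩)
  let e₁ : Fin n ⊕ Unit ≃ Fin (n + 1) := Equiv.ofBijective
    (Sum.elim Fin.castSucc fun _ => Fin.last n) (by
      constructor
      · rintro (x | x) (y | y) hxy <;> simp [Fin.ext_iff] at hxy ⊢ <;> omega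
      · intro y
        rcases Fin.eq_castSucc_or_eq_last y with ⟨x, rfl⟩ | rfl
        · exact ⟨Sum.inl x, rfl⟩
        · exact ⟨Sum.inr (), rfl⟩)
  let e₂ : Fin n ⊕ Fin 2 ≃ Fin (n + 2) := Equiv.ofBijective
    (Sum.elim (fun i => i.succ.castSucc) ![0, Fin.last (n + 1)]) (by
      constructor
      · rintro (x | x) (y | y) hxy
        · simpa [Fin.ext_iff] using hxy
        · fin_cases y <;> simp [Fin.ext_iff] at hxy <;> omega
        · fin_cases x <;> simp [Fin.ext_iff] at hxy <;> omega
        · fin_cases x <;> fin_cases y <;> simp [Fin.ext_iff] at hxy ⊢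
      · intro y
        rcases Fin.eq_castSucc_or_eq_last y with ⟨x, rfl⟩ | rfl
        · rcases Fin.eq_zero_or_eq_succ x with rfl | ⟨x, rfl⟩
          · exact ⟨Sum.inr 0, rfl⟩
          · exact ⟨Sum.inl x, rfl⟩
        · exact ⟨Sum.inr 1, rfl⟩)
  have h₀l : ∀ i, e₀ (Sum.inl i) = i.succ := fun _ => rfl
  have h₀r : ∀ i, e₀ (Sum.inr i) = 0 := fun _ => rfl
  have h₁l : ∀ i, e₁ (Sum.inl i) = i.castSucc := fun _ => rfl
  have h₁r : ∀ i, e₁ (Sum.inr i) = Fin.last n := fun _ => rfl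
  have h₂l : ∀ i, e₂ (Sum.inl i) = i.succ.castSucc := fun _ => rfl
  have h₂r : ∀ i, e₂ (Sum.inr i) = ![0, Fin.last (n + 1)] i := fun _ => rfl
  let u : Fin 2 → Fin n → K := ![fun i => f (m + 1 + i), fun i => f (m + n + 2 + i)]
  let d : Fin 2 → Fin 2 → K := ![![f m, f (m + n + 1)], ![f (m + n + 1), f (m + 2 * n + 2)]]
  -- The Schur complement of the central block `N`. The bordered minors are `N.det` times its
  -- entries, up to sign, and the full determinant is `N.det` times its determinant.
  let s : Fin 2 → Fin 2 → K := fun x y => d x y - u x ⬝ᵥ (N⁻¹.mulVec (u y))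
  have hs : s 1 0 = s 0 1 := by
    simp only [s]
    congr 1
    rw [Matrix.dotProduct_mulVec, ← Matrix.mulVec_transpose, Matrix.transpose_nonsing_inv, hT,
      dotProduct_comm]
  have h00 : hankelDet f m (n + 1) = N.det * s 0 0 := by
    rw [← det_border N hdet, hankelDet, ← Matrix.det_submatrix_equiv_self e₀]
    congr 1
    ext (i | i) (j | j) <;> simp [h₀l, h₀r, u, d, hN] <;> congr 1 <;> ring
  have h11 : hankelDet f (m + 2) (n + 1) = N.det * s 1 1 := by
    rw [← det_border N hdet, hankelDet, ← Matrix.det_submatrix_equiv_self e₁]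
    congr 1
    ext (i | i) (j | j) <;> simp [h₁l, h₁r, u, d, hN] <;> congr 1 <;> ring
  -- Rows and columns are reordered differently, so the sign is lost; it is irrelevant because this
  -- minor enters squared.
  have h01 : |hankelDet f (m + 1) (n + 1)| = |N.det * s 0 1| := by
    rw [← det_border N hdet, hankelDet, ← Matrix.abs_det_submatrix_equiv_equiv e₀ e₁]
    congr 2
    ext (i | i) (j | j) <;> simp [h₀l, h₀r, h₁l, h₁r, u, d, hN] <;> congr 1 <;> ring
  have h2 : hankelDet f m (n + 2) = N.det * (s 0 0 * s 1 1 - s 0 1 * s 1 0) := by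
    have : Invertible N := Matrix.invertibleOfIsUnitDet N (isUnit_iff_ne_zero.2 hdet)
    have h3 := Matrix.det_fromBlocks₁₁ N (Matrix.of fun i x => u x i) (Matrix.of fun x j => u x j)
      (Matrix.of fun x y => d x y)
    rw [Matrix.invOf_eq_nonsing_inv, Matrix.mul_assoc, Matrix.det_fin_two] at h3
    rw [hankelDet, ← Matrix.det_submatrix_equiv_self e₂]
    refine (congrArg Matrix.det ?_).trans h3
    ext (i | i) (j | j)
    · simp [h₂l, hN]; congr 1; ring
    · fin_cases j <;> simp [h₂l, h₂r, u] <;> congr 1 <;> ring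
    · fin_cases i <;> simp [h₂l, h₂r, u] <;> congr 1 <;> ring
    · fin_cases i <;> fin_cases j <;> simp [h₂r, d] <;> congr 1 <;> ring
  have h4 : hankelDet f (m + 1) (n + 1) ^ 2 = (N.det * s 0 1) ^ 2 :=
    (sq_eq_sq_iff_abs_eq_abs _ _).2 h01
  have h5 : hankelDet f (m + 2) n = N.det := rfl
  rw [h00, h11, h2, h4, h5, hs]
  ring

/-! ### Evaluation of the Catalan Hankel determinants. -/

/-- The absolute value of the quotient of consecutively shifted Catalan Hankel determinants. -/
def hankelRatio (s k : ℕ) : ℚ :=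
  ((2 * s + 2 * k).factorial * s.factorial : ℚ) / ((s + 2 * k).factorial * (2 * s).factorial)

/-- The absolute value of the Hankel determinant of Catalan numbers. -/
def hankelProd (m k : ℕ) : ℚ := ∏ s ∈ range m, hankelRatio s k

theorem hankelRatio_pos (s k : ℕ) : 0 < hankelRatio s k := by
  unfold hankelRatio
  positivity

theorem hankelProd_pos (m k : ℕ) : 0 < hankelProd m k :=
  prod_pos fun s _ => hankelRatio_pos s k

theorem hankelProd_succ (m k : ℕ) : hankelProd (m + 1) k = hankelProd m k * hankelRatio m k :=
  prod_range_succ _ _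

/-- Changing the order, like changing the shift, multiplies by an explicit factorial quotient, so
condensation reduces to a rational identity. -/
theorem hankelProd_succ_right (m k : ℕ) :
    hankelProd m (k + 1) = hankelProd m k * (((2 * m + 2 * k).factorial * (2 * k + 1).factorial : ℚ)
      / ((m + 2 * k).factorial * (m + 2 * k + 1).factorial)) := by
  induction m with
  | zero => simp [hankelProd]; field_simp
  | succ m ih =>
    rw [hankelProd_succ, hankelProd_succ, ih, hankelRatio, hankelRatio,
      show 2 * m + 2 * (k + 1) = 2 * m + 2 * k + 1 + 1 by ring,
      show 2 * (m + 1) + 2 * k = 2 * m + 2 * k + 1 + 1 by ring,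
      show m + 2 * (k + 1) = m + 2 * k + 1 + 1 by ring,
      show m + 1 + 2 * k = m + 2 * k + 1 by ring]
    simp only [Nat.factorial_succ]
    push_cast
    field_simp

theorem hankelProd_condensation (m n : ℕ) :
    hankelProd m (n + 1) * hankelProd (m + 2) (n + 1) =
      hankelProd m (n + 2) * hankelProd (m + 2) n + hankelProd (m + 1) (n + 1) ^ 2 := by
  simp only [hankelProd_succ, hankelProd_succ_right, hankelRatio]
  rw [show 2 * m + 2 * (n + 1) = 2 * m + 2 * n + 1 + 1 by ring,
    show 2 * (m + 1) + 2 * (n + 1) = 2 * m + 2 * n + 1 + 1 + 1 + 1 by ring,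
    show 2 * (m + 1) + 2 * n = 2 * m + 2 * n + 1 + 1 by ring,
    show m + 1 + 2 * (n + 1) = m + 2 * n + 1 + 1 + 1 by ring,
    show m + 2 * (n + 1) = m + 2 * n + 1 + 1 by ring,
    show m + 1 + 2 * n = m + 2 * n + 1 by ring,
    show 2 * (m + 1) = 2 * m + 1 + 1 by ring,
    show 2 * (n + 1) + 1 = 2 * n + 1 + 1 + 1 by ring]
  simp only [Nat.factorial_succ]
  push_cast
  field_simp
  ring

theorem hankelDet_intCast (f : ℕ → ℤ) (m k : ℕ) :
    ((hankelDet f m k : ℤ) : ℚ) = hankelDet (fun i => (f i : ℚ)) m k := by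
  rw [hankelDet, Int.cast_det]
  rfl

/-- Condensation determines the value at shift m + 2 and order n + 1 from smaller shifts or orders.
Positivity of `hankelProd` permits the division, and the signs (-1)^(mk) cancel in every term. -/
theorem hankelDet_signedCatalan (m k : ℕ) :
    ((hankelDet signedCatalan m k : ℤ) : ℚ) = (-1) ^ (m * k) * hankelProd m k := by
  induction m using Nat.strong_induction_on generalizing k with
  | _ m ih =>
    match m with
    | 0 => simp [hankelDet_signedCatalan_zero, hankelProd]
    | 1 =>
      rw [hankelDet_signedCatalan_one, hankelProd]
      simp [hankelRatio, Nat.factorial_ne_zero]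
    | m + 2 =>
      induction k with
      | zero => simp [hankelDet, hankelProd, hankelRatio, mul_comm, div_self, Nat.factorial_ne_zero]
      | succ n ihn =>
        have h0 : (hankelDet (fun i => (signedCatalan i : ℚ)) (m + 2) n) ≠ 0 := by
          rw [← hankelDet_intCast, ihn]
          exact mul_ne_zero (pow_ne_zero _ (by norm_num)) (hankelProd_pos _ _).ne'
        have h := hankelDet_condensation _ m n h0
        simp only [← hankelDet_intCast] at h
        rw [ihn, ih m (by omega), ih m (by omega), ih (m + 1) (by omega)] at h
        have hc := hankelProd_condensation m n
        have h1 : ((-1 : ℚ) ^ (m * (n + 1))) * hankelProd m (n + 1) ≠ 0 :=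
          mul_ne_zero (pow_ne_zero _ (by norm_num)) (hankelProd_pos _ _).ne'
        refine mul_left_cancel₀ h1 (h.trans ?_)
        have e1 : ((-1 : ℚ) ^ (m * (n + 2))) * (-1) ^ ((m + 2) * n) = 1 := by
          rw [← pow_add]
          exact Even.neg_one_pow ⟨m * n + m + n, by ring⟩
        have e2 : ((-1 : ℚ) ^ (m * (n + 1))) * (-1) ^ ((m + 2) * (n + 1)) = 1 := by
          rw [← pow_add]
          exact Even.neg_one_pow ⟨m * n + m + n + 1, by ring⟩
        have e3 : (((-1 : ℚ) ^ ((m + 1) * (n + 1)))) ^ 2 = 1 := by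
          rw [← pow_mul]
          exact Even.neg_one_pow ⟨(m + 1) * (n + 1), by ring⟩
        linear_combination hankelProd m (n + 2) * hankelProd (m + 2) n * e1
          - hankelProd m (n + 1) * hankelProd (m + 2) (n + 1) * e2
          + hankelProd (m + 1) (n + 1) ^ 2 * e3 - hc

/-! ### Conversion to shifted factorials. -/

theorem shiftedFactorial_natCast_succ (x n : ℕ) :
    shiftedFactorial (x + 1 : ℕ) n = ((x + n).factorial : ℚ) / x.factorial := by
  rw [shiftedFactorial, ← ascPochhammer_eval_cast, ascPochhammer_nat_eq_ascFactorial,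
    eq_div_iff (by positivity), ← Nat.factorial_mul_ascFactorial]
  push_cast
  ring

/-- The window p, …, 2p - 1 becomes p + 1, …, 2p + 1: one factor leaves and two enter. -/
theorem prod_range_shift (F : ℕ → ℚ) (p : ℕ) :
    (∏ j ∈ range (p + 1), F (p + 1 + j)) * F p =
      (∏ j ∈ range p, F (p + j)) * (F (2 * p) * F (2 * p + 1)) := by
  have h := (prod_range_succ' (fun j => F (p + j)) (p + 1)).symm.trans (prod_range_succ _ _)
  rw [prod_range_succ (fun j => F (p + j)) p, mul_assoc, ← two_mul, ← add_assoc, ← two_mul] at h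
  rw [← h]
  simp only [add_zero]
  congr 1
  exact prod_congr rfl fun j _ => by congr 1; ring

theorem prod_range_shift_step {A F C : ℕ → ℚ} (hF : ∀ x, F x ≠ 0) (p : ℕ) :
    ∏ j ∈ range (p + 1), A j * F (p + 1 + j) / C j =
      (∏ j ∈ range p, A j * F (p + j) / C j) * (A p * (F (2 * p) * F (2 * p + 1)) / (C p * F p)) := by
  have h := prod_range_shift F p
  rw [← eq_div_iff (hF p)] at h
  simp only [prod_div_distrib, prod_mul_distrib]
  rw [h, prod_range_succ A, prod_range_succ C]
  field_simp

theorem shiftedFactorial_natCast_succ_ne_zero (x n : ℕ) :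
    shiftedFactorial (x + 1 : ℕ) n ≠ 0 := by
  rw [shiftedFactorial_natCast_succ]
  positivity

/-- The case a = 2p + 1, with the factors (a - j)_b in reverse order so that they form a sliding
window in p. -/
theorem prod_shiftedFactorial_odd (p b : ℕ) :
    ∏ j ∈ range p, (((b / 2 : ℕ) + (j + 1 : ℕ) : ℚ) * shiftedFactorial (p + j + 1 : ℕ) b
      / shiftedFactorial (j + 1 : ℕ) (b + 1)) =
      hankelProd p ((b + 1) / 2) * hankelProd (p + 1) (b / 2) := by
  induction p with
  | zero => simp [hankelProd, hankelRatio]; field_simp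
  | succ p ih =>
    rw [prod_range_shift_step (A := fun j => ((b / 2 : ℕ) + (j + 1 : ℕ) : ℚ))
      (F := fun x => shiftedFactorial (x + 1 : ℕ) b)
      (fun x => shiftedFactorial_natCast_succ_ne_zero x b), ih,
      hankelProd_succ p ((b + 1) / 2), hankelProd_succ (p + 1), mul_mul_mul_comm _ (hankelRatio p _)]
    congr 1
    simp only [shiftedFactorial_natCast_succ, hankelRatio]
    obtain ⟨c, rfl | rfl⟩ := b.even_or_odd'
    · rw [show 2 * c / 2 = c by omega, show (2 * c + 1) / 2 = c by omega,
        show 2 * p + 1 + 2 * c = 2 * p + 2 * c + 1 by ring,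
        show 2 * (p + 1) + 2 * c = 2 * p + 2 * c + 1 + 1 by ring,
        show p + (2 * c + 1) = p + 2 * c + 1 by ring,
        show p + 1 + 2 * c = p + 2 * c + 1 by ring, show 2 * (p + 1) = 2 * p + 1 + 1 by ring]
      simp only [Nat.factorial_succ]
      push_cast
      field_simp
      ring
    · rw [show (2 * c + 1) / 2 = c by omega, show (2 * c + 1 + 1) / 2 = c + 1 by omega,
        show 2 * p + (2 * c + 1) = 2 * p + 2 * c + 1 by ring,
        show 2 * p + 1 + (2 * c + 1) = 2 * p + 2 * c + 1 + 1 by ring,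
        show 2 * p + 2 * (c + 1) = 2 * p + 2 * c + 1 + 1 by ring,
        show 2 * (p + 1) + 2 * c = 2 * p + 2 * c + 1 + 1 by ring,
        show p + (2 * c + 1 + 1) = p + 2 * c + 1 + 1 by ring,
        show p + (2 * c + 1) = p + 2 * c + 1 by ring,
        show p + 2 * (c + 1) = p + 2 * c + 1 + 1 by ring,
        show p + 1 + 2 * c = p + 2 * c + 1 by ring, show 2 * (p + 1) = 2 * p + 1 + 1 by ring]
      simp only [Nat.factorial_succ]
      push_cast
      field_simp
      ring

/-- The case a = 2q + 2, b = 2c, with the same reversal. -/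
theorem prod_shiftedFactorial_even (q c : ℕ) :
    ∏ j ∈ range q, ((c + (j + 1 : ℕ) : ℚ) * shiftedFactorial (q + j + 1 + 1 : ℕ) (2 * c)
      / shiftedFactorial (j + 1 : ℕ) (2 * c + 1)) = hankelProd (q + 1) c ^ 2 := by
  induction q with
  | zero => simp [hankelProd, hankelRatio, Nat.factorial_ne_zero]
  | succ q ih =>
    rw [prod_range_shift_step (A := fun j => (c + (j + 1 : ℕ) : ℚ))
      (F := fun x => shiftedFactorial (x + 1 + 1 : ℕ) (2 * c))
      (fun x => shiftedFactorial_natCast_succ_ne_zero (x + 1) _), ih, hankelProd_succ (q + 1),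
      mul_pow]
    congr 1
    simp only [shiftedFactorial_natCast_succ, hankelRatio]
    rw [show 2 * q + 1 + 2 * c = 2 * q + 2 * c + 1 by ring,
      show 2 * q + 1 + 1 + 2 * c = 2 * q + 2 * c + 1 + 1 by ring,
      show 2 * (q + 1) + 2 * c = 2 * q + 2 * c + 1 + 1 by ring,
      show q + (2 * c + 1) = q + 2 * c + 1 by ring,
      show q + 1 + 2 * c = q + 2 * c + 1 by ring, show 2 * (q + 1) = 2 * q + 1 + 1 by ring]
    simp only [Nat.factorial_succ]
    push_cast
    field_simp
    ring

/-! ### Checkerboard Hankel matrices. -/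

/-- The splitting of the first natural numbers into even and odd ones. -/
noncomputable def evenOddEquiv (b : ℕ) : Fin ((b + 1) / 2) ⊕ Fin (b / 2) ≃ Fin b :=
  Equiv.ofBijective (Sum.elim (fun i => ⟨2 * i, by omega⟩) (fun i => ⟨2 * i + 1, by omega⟩)) (by
    constructor
    · rintro (x | x) (y | y) hxy <;> simp [Fin.ext_iff] at hxy ⊢ <;> omega
    · rintro ⟨y, hy⟩
      obtain ⟨c, rfl | rfl⟩ := y.even_or_odd'
      · exact ⟨Sum.inl ⟨c, by omega⟩, rfl⟩
      · exact ⟨Sum.inr ⟨c, by omega⟩, rfl⟩)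

theorem evenOddEquiv_inl (b : ℕ) (i : Fin ((b + 1) / 2)) :
    (evenOddEquiv b (Sum.inl i) : ℕ) = 2 * i := rfl

theorem evenOddEquiv_inr (b : ℕ) (i : Fin (b / 2)) :
    (evenOddEquiv b (Sum.inr i) : ℕ) = 2 * i + 1 := rfl

/-- For odd shift, entries vanish unless both indices have the same parity; sorting by parity gives
a block diagonal matrix. -/
theorem hankelDet_odd_of_sparse {R : Type*} [CommRing R] {f g : ℕ → R}
    (hodd : ∀ t, f (2 * t + 1) = g t) (heven : ∀ t, f (2 * t + 2) = 0) (p b : ℕ) :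
    hankelDet f (2 * p + 1) b = hankelDet g p ((b + 1) / 2) * hankelDet g (p + 1) (b / 2) := by
  rw [hankelDet, ← Matrix.det_submatrix_equiv_self (evenOddEquiv b), hankelDet, hankelDet,
    ← Matrix.det_fromBlocks_zero₂₁ _ 0]
  congr 1
  ext (i | i) (j | j)
  · simp only [Matrix.submatrix_apply, Matrix.of_apply, Matrix.fromBlocks_apply₁₁,
      evenOddEquiv_inl, ← hodd]
    congr 1
    ring
  · simp only [Matrix.submatrix_apply, Matrix.of_apply, Matrix.fromBlocks_apply₁₂,
      evenOddEquiv_inl, evenOddEquiv_inr, Matrix.zero_apply]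
    rw [← heven (p + i + j)]
    congr 1
    ring
  · simp only [Matrix.submatrix_apply, Matrix.of_apply, Matrix.fromBlocks_apply₂₁,
      evenOddEquiv_inl, evenOddEquiv_inr, Matrix.zero_apply]
    rw [← heven (p + i + j)]
    congr 1
    ring
  · simp only [Matrix.submatrix_apply, Matrix.of_apply, Matrix.fromBlocks_apply₂₂,
      evenOddEquiv_inr, ← hodd]
    congr 1
    ring

theorem Matrix.det_fromBlocks_zero_self {R n : Type*} [CommRing R] [Fintype n] [DecidableEq n]
    (B : Matrix n n R) :
    (Matrix.fromBlocks 0 B B 0).det = (-1) ^ Fintype.card n * B.det ^ 2 := by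
  have h : Matrix.fromBlocks 1 1 0 1 * Matrix.fromBlocks 0 B B 0 * Matrix.fromBlocks 1 (-1) 0 1 =
      Matrix.fromBlocks B 0 B (-B) := by
    simp [Matrix.fromBlocks_multiply]
  have h' := congrArg Matrix.det h
  rw [Matrix.det_mul, Matrix.det_mul, Matrix.det_fromBlocks_zero₂₁, Matrix.det_fromBlocks_zero₂₁,
    Matrix.det_fromBlocks_zero₁₂, Matrix.det_neg] at h'
  simp only [Matrix.det_one, one_mul, mul_one] at h'
  rw [h']
  ring

/-- For even shift only indices of opposite parity interact, which leaves two equal antidiagonal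
blocks. -/
theorem hankelDet_even_of_sparse {R : Type*} [CommRing R] {f g : ℕ → R}
    (hodd : ∀ t, f (2 * t + 1) = g t) (heven : ∀ t, f (2 * t + 2) = 0) (p c : ℕ) :
    hankelDet f (2 * p + 2) (2 * c) = (-1) ^ c * hankelDet g (p + 1) c ^ 2 := by
  rw [hankelDet, ← Matrix.det_submatrix_equiv_self
    ((Equiv.sumCongr (finCongr (by omega)) (finCongr (by omega))).trans (evenOddEquiv (2 * c)) :
      Fin c ⊕ Fin c ≃ Fin (2 * c)), hankelDet]
  have h := Matrix.det_fromBlocks_zero_self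
    (Matrix.of fun i j : Fin c => g (p + 1 + i + j))
  rw [Fintype.card_fin] at h
  rw [← h]
  congr 1
  ext (i | i) (j | j)
  · simp only [Matrix.submatrix_apply, Matrix.of_apply, Matrix.fromBlocks_apply₁₁,
      evenOddEquiv_inl, Equiv.trans_apply, Equiv.sumCongr_apply, Sum.map_inl, finCongr_apply,
      Fin.val_cast, Matrix.zero_apply]
    rw [← heven (p + i + j)]
    congr 1
    ring
  · simp only [Matrix.submatrix_apply, Matrix.of_apply, Matrix.fromBlocks_apply₁₂,
      evenOddEquiv_inl, evenOddEquiv_inr, Equiv.trans_apply, Equiv.sumCongr_apply, Sum.map_inl,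
      Sum.map_inr, finCongr_apply, Fin.val_cast, ← hodd]
    congr 1
    ring
  · simp only [Matrix.submatrix_apply, Matrix.of_apply, Matrix.fromBlocks_apply₂₁,
      evenOddEquiv_inl, evenOddEquiv_inr, Equiv.trans_apply, Equiv.sumCongr_apply, Sum.map_inl,
      Sum.map_inr, finCongr_apply, Fin.val_cast, ← hodd]
    congr 1
    ring
  · simp only [Matrix.submatrix_apply, Matrix.of_apply, Matrix.fromBlocks_apply₂₂,
      evenOddEquiv_inr, Equiv.trans_apply, Equiv.sumCongr_apply, Sum.map_inr, finCongr_apply,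
      Fin.val_cast, Matrix.zero_apply]
    rw [← heven (p + i + j + 1)]
    congr 1
    ring

/-- Conjugation by the signs (-1)^i negates the matrix, so in odd order the determinant is its own
negative. -/
theorem hankelDet_even_odd_of_sparse {f : ℕ → ℤ} (heven : ∀ t, f (2 * t + 2) = 0) (p : ℕ) {b : ℕ}
    (hb : Odd b) : hankelDet f (2 * p + 2) b = 0 := by
  set M := Matrix.of fun i j : Fin b => f (2 * p + 2 + i + j)
  have h : (Matrix.of fun i j : Fin b => (-1 : ℤ) ^ (i : ℕ) *
      (Matrix.of fun i j : Fin b => (-1 : ℤ) ^ (j : ℕ) * M i j) i j).det = (-M).det := by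
    congr 1
    ext i j
    simp only [Matrix.of_apply, Matrix.neg_apply, M]
    rcases (i + j : ℕ).even_or_odd' with ⟨c, hc | hc⟩
    · rw [show 2 * p + 2 + (i : ℕ) + j = 2 * (p + c) + 2 by omega, heven]
      simp
    · rw [← mul_assoc, ← pow_add, hc, Odd.neg_one_pow ⟨c, rfl⟩]
      ring
  rw [Matrix.det_mul_column, Matrix.det_mul_row, Matrix.det_neg, Fintype.card_fin, hb.neg_one_pow,
    ← mul_assoc, ← prod_mul_distrib] at h
  simp only [← pow_add, ← two_mul, pow_mul, neg_one_sq, one_pow, prod_const_one, one_mul] at h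
  have : M.det = 0 := by linarith
  exact this

/-! ### The product formula for the signed Hankel determinant. -/

theorem moment_single_odd (t : ℕ) :
    moment (-1) (Pi.single 0 1) (2 * t + 1) = signedCatalan t := by
  rw [moment_succ_of_single, moment_zero_two_mul]

theorem moment_single_even (t : ℕ) : moment (-1) (Pi.single 0 1) (2 * t + 2) = 0 := by
  rw [moment_succ_of_single, moment_zero_of_odd ⟨t, rfl⟩]

theorem nat_ceil_half (a : ℕ) : ⌈(a : ℚ) / 2⌉₊ = (a + 1) / 2 := by
  obtain ⟨c, rfl | rfl⟩ := a.even_or_odd'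
  · rw [show (2 * c + 1) / 2 = c by omega]
    push_cast
    rw [mul_div_cancel_left₀ _ (by norm_num), Nat.ceil_natCast]
  · rw [show (2 * c + 1 + 1) / 2 = c + 1 by omega, Nat.ceil_eq_iff (by omega)]
    push_cast
    constructor <;> linarith

theorem nat_floor_half (b : ℕ) : ⌊(b : ℚ) / 2⌋₊ = b / 2 := by
  exact_mod_cast Nat.floor_div_eq_div (K := ℚ) b 2

theorem prod_Icc_one_eq_prod_range {M : Type*} [CommMonoid M] (n : ℕ) (F : ℕ → M) :
    ∏ j ∈ Icc 1 n, F j = ∏ j ∈ range n, F (j + 1) := by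
  induction n with
  | zero => simp
  | succ n ih => rw [prod_Icc_succ_top (by omega), ih, prod_range_succ]

theorem prod_fin_neg_one_pow (b : ℕ) : ∏ i : Fin b, (-1 : ℤ) ^ (i : ℕ) = (-1) ^ (b / 2) := by
  rw [Fin.prod_univ_eq_prod_range fun i => (-1 : ℤ) ^ i]
  induction b with
  | zero => simp
  | succ b ih =>
    rw [prod_range_succ, ih]
    obtain ⟨c, rfl | rfl⟩ := b.even_or_odd'
    · rw [show 2 * c / 2 = c by omega, show (2 * c + 1) / 2 = c by omega, pow_mul]
      simp
    · rw [show (2 * c + 1) / 2 = c by omega, show (2 * c + 1 + 1) / 2 = c + 1 by omega,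
        Odd.neg_one_pow ⟨c, rfl⟩, pow_succ]

/-- The product formula for the signed Hankel determinant. -/
theorem sign_mul_hankelDet_moment (a b : ℕ) (ha : 1 ≤ a) :
    (((-1 : ℤ) ^ (b * (a / 2)) * ((∏ i : Fin b, (-1) ^ (i : ℕ)) *
      hankelDet (moment (-1) (Pi.single 0 1)) a b) : ℤ) : ℚ) =
      if Odd b ∧ Even a then 0
      else ∏ j ∈ Icc 1 (⌈(a : ℚ) / 2⌉₊ - 1),
        ((⌊(b : ℚ) / 2⌋₊ : ℚ) + (j : ℚ)) * shiftedFactorial ((a : ℚ) - (j : ℚ)) b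
          / shiftedFactorial (j : ℚ) (b + 1) := by
  rw [prod_fin_neg_one_pow, nat_ceil_half, nat_floor_half, prod_Icc_one_eq_prod_range]
  obtain ⟨p, rfl | rfl⟩ := a.even_or_odd'
  · obtain ⟨q, rfl⟩ : ∃ q, p = q + 1 := ⟨p - 1, by omega⟩
    obtain ⟨c, rfl | rfl⟩ := b.even_or_odd'
    · rw [if_neg (by simp), mul_add, mul_one, hankelDet_even_of_sparse moment_single_odd
        moment_single_even, show (2 * q + 2 + 1) / 2 - 1 = q by omega,
        show 2 * c / 2 = c by omega, ← mul_assoc ((-1) ^ c), ← pow_add, ← two_mul, mul_assoc 2,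
        pow_mul, pow_mul]
      push_cast
      have h1 : ∀ x : ℕ, ((-1 : ℚ) ^ x) ^ 2 = 1 := fun x => by
        rw [← pow_mul, mul_comm, pow_mul, neg_one_sq, one_pow]
      rw [hankelDet_signedCatalan, mul_pow, h1, ← prod_shiftedFactorial_even, pow_mul]
      simp only [neg_one_sq, one_pow, one_mul]
      simp only [prod_div_distrib, prod_mul_distrib]
      congr 2
      · simp
      · rw [← prod_range_reflect]
        refine prod_congr rfl fun j hj => ?_
        rw [mem_range] at hj
        congr 1
        rw [show q + (q - 1 - j) + 1 + 1 = 2 * q + 1 - j by omega,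
          Nat.cast_sub (by omega)]
        push_cast
        ring
      · simp
    · rw [if_pos ⟨⟨c, rfl⟩, by simp⟩, mul_add, mul_one,
        hankelDet_even_odd_of_sparse moment_single_even q ⟨c, rfl⟩]
      simp
  · rw [if_neg (by simp), hankelDet_odd_of_sparse moment_single_odd moment_single_even,
      show (2 * p + 1 + 1) / 2 - 1 = p by omega, show (2 * p + 1) / 2 = p by omega]
    push_cast
    rw [hankelDet_signedCatalan, hankelDet_signedCatalan]
    have hsign : (-1 : ℚ) ^ (b * p) * (-1) ^ (b / 2) * (-1) ^ (p * ((b + 1) / 2)) *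
        (-1) ^ ((p + 1) * (b / 2)) = 1 := by
      rw [← pow_add, ← pow_add, ← pow_add]
      refine Even.neg_one_pow ⟨b * p + b / 2, ?_⟩
      have : b = (b + 1) / 2 + b / 2 := by omega
      generalize (b + 1) / 2 = x at *
      generalize b / 2 = y at *
      subst this
      ring
    have hprod := prod_shiftedFactorial_odd p b
    trans hankelProd p ((b + 1) / 2) * hankelProd (p + 1) (b / 2)
    · linear_combination hankelProd p ((b + 1) / 2) * hankelProd (p + 1) (b / 2) * hsign
    · rw [← hprod]
      simp only [prod_div_distrib, prod_mul_distrib]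
      congr 2
      · simp
      · rw [← prod_range_reflect]
        refine prod_congr rfl fun j hj => ?_
        rw [mem_range] at hj
        congr 1
        rw [show p + (p - 1 - j) + 1 = 2 * p - j by omega, Nat.cast_sub (by omega)]
        push_cast
        ring
      · simp

/-! ### Signed nonintersecting paths as a determinant. -/

/-- Prepending a value to a sequence. -/
def consSeq {α : Type*} (x : α) (f : ℕ → α) : ℕ → α
  | 0 => x
  | s + 1 => f s

open Classical in
/-- The sequences starting in `x` that follow the relation `next` for `m` steps and are constant
afterwards. -/
noncomputable def chains {α : Type*} (next : α → Finset α) : ℕ → α → Finset (ℕ → α)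
  | 0, x => {fun _ => x}
  | m + 1, x => (next x).biUnion fun y => (chains next m y).image (consSeq x)

theorem mem_chains {α : Type*} {next : α → Finset α} {m : ℕ} {x : α} {f : ℕ → α} :
    f ∈ chains next m x ↔
      f 0 = x ∧ (∀ s < m, f (s + 1) ∈ next (f s)) ∧ ∀ s, m ≤ s → f s = f m := by
  induction m generalizing x f with
  | zero =>
    simp only [chains, mem_singleton]
    constructor
    · rintro rfl
      simp
    · rintro ⟨h0, -, h⟩
      ext s
      rw [h s (Nat.zero_le s), h0]
  | succ m ih =>
    simp only [chains, mem_biUnion, mem_image]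
    constructor
    · rintro ⟨y, hy, g, hg, rfl⟩
      obtain ⟨h0, h1, h2⟩ := ih.1 hg
      refine ⟨rfl, ?_, ?_⟩
      · rintro (_ | s) hs
        · change g 0 ∈ next x
          rwa [h0]
        · exact h1 s (by omega)
      · rintro (_ | s) hs
        · omega
        · exact h2 s (by omega)
    · rintro ⟨rfl, h1, h2⟩
      refine ⟨f 1, h1 0 (by omega), fun s => f (s + 1), ih.2 ⟨rfl, ?_, ?_⟩, ?_⟩
      · exact fun s hs => h1 (s + 1) (by omega)
      · exact fun s hs => h2 (s + 1) (by omega)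
      · ext s
        rcases s with _ | s <;> rfl

theorem consSeq_injective {α : Type*} (x : α) : Function.Injective (consSeq x) :=
  fun _ _ h => funext fun s => congrFun h (s + 1)

theorem sum_chains_succ {α R : Type*} [CommRing R] (next : α → Finset α) (m : ℕ) (x : α)
    (g : (ℕ → α) → R) :
    ∑ f ∈ chains next (m + 1) x, g f = ∑ y ∈ next x, ∑ f ∈ chains next m y, g (consSeq x f) := by
  classical
  rw [chains, sum_biUnion]
  · refine sum_congr rfl fun y _ => ?_
    rw [sum_image (consSeq_injective x).injOn]
  · intro y _ z _ hyz
    rw [Function.onFun, disjoint_left]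
    intro f hf hf'
    obtain ⟨g, hg, rfl⟩ := mem_image.1 hf
    obtain ⟨g', hg', h⟩ := mem_image.1 hf'
    obtain rfl := consSeq_injective x h
    exact hyz ((mem_chains.1 hg).1.symm.trans (mem_chains.1 hg').1)

section nonintersecting

variable {b : ℕ}

open Classical in
/-- The admissible configurations of `b` nonintersecting particles after one step. -/
noncomputable def nextStates (x : Fin b → ℤ) : Finset (Fin b → ℤ) :=
  {y ∈ Fintype.piFinset fun t => {x t - 1, x t + 1} | StrictMono y ∧ ∀ t, 0 ≤ y t}

theorem mem_nextStates {x y : Fin b → ℤ} : y ∈ nextStates x ↔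
    (∀ t, y t = x t - 1 ∨ y t = x t + 1) ∧ StrictMono y ∧ ∀ t, 0 ≤ y t := by
  simp [nextStates]

/-- The configuration of particles at heights `0, 2, 4, …`. -/
def packedState (b : ℕ) : Fin b → ℤ := fun t => 2 * (t : ℕ)

/-- The sign of a particle at height `x`. -/
def heightSign (x : ℤ) : ℤ := (x / 2).negOnePow

/-- The signed sum over all configuration sequences of length `m` leading from `x` to the packed
configuration. -/
noncomputable def signedChainSum (m : ℕ) (x : Fin b → ℤ) : ℤ :=
  ∑ f ∈ chains nextStates m x, if f m = packedState b then
    ∏ s ∈ range m, ∏ t, heightSign (f (s + 1) t) else 0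

theorem signedChainSum_succ (m : ℕ) (x : Fin b → ℤ) :
    signedChainSum (m + 1) x =
      ∑ y ∈ nextStates x, (∏ t, heightSign (y t)) * signedChainSum m y := by
  rw [signedChainSum, sum_chains_succ]
  refine sum_congr rfl fun y _ => ?_
  rw [signedChainSum, mul_sum]
  refine sum_congr rfl fun f hf => ?_
  obtain ⟨h0, -⟩ := mem_chains.1 hf
  simp only [prod_range_succ', consSeq, h0, mul_ite, mul_zero]
  rw [mul_comm]

/-- The one-particle transfer operator. -/
def transfer (φ : ℤ → ℤ) (x : ℤ) : ℤ :=
  if x < 0 then 0 else heightSign (x - 1) * φ (x - 1) + heightSign (x + 1) * φ (x + 1)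

theorem transfer_iterate_single_neg (m j : ℕ) {x : ℤ} (hx : x < 0) :
    transfer^[m] (Pi.single (2 * (j : ℤ)) 1) x = 0 := by
  rcases m with _ | m
  · simp only [Function.iterate_zero, id]
    exact Pi.single_eq_of_ne (by omega) 1
  · rw [Function.iterate_succ_apply', transfer, if_pos hx]

theorem sum_piFinset_prod_mul_det (s : Fin b → Finset ℤ) (w : ℤ → ℤ) (φ : Fin b → ℤ → ℤ) :
    ∑ y ∈ Fintype.piFinset s, (∏ t, w (y t)) * (Matrix.of fun i j => φ j (y i)).det =
      (Matrix.of fun i j => ∑ z ∈ s i, w z * φ j z).det := by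
  have h := (Matrix.detRowAlternating (n := Fin b) (R := ℤ)).toMultilinearMap.map_sum_finset
    (fun _ z j => w z * φ j z) s
  have h' : (Matrix.of fun i j => ∑ z ∈ s i, w z * φ j z) =
      fun i => ∑ z ∈ s i, fun j => w z * φ j z := by
    ext i j
    simp
  rw [h']
  refine Eq.trans ?_ h.symm
  refine sum_congr rfl fun y _ => ?_
  rw [← Matrix.det_mul_column]
  rfl

/-- Multilinearity in the rows expands the determinant over all independent ±1 moves. Inadmissible
moves contribute zero: a collision gives equal rows, and a negative height gives a zero row. -/
theorem signedChainSum_eq_det (m : ℕ) {x : Fin b → ℤ} (hx : StrictMono x) (h0 : ∀ t, 0 ≤ x t)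
    (hpar : ∀ t, x t % 2 = m % 2) :
    signedChainSum m x =
      (Matrix.of fun i j : Fin b => transfer^[m] (Pi.single (2 * ((j : ℕ) : ℤ)) 1) (x i)).det := by
  induction m generalizing x with
  | zero =>
    simp only [signedChainSum, chains, sum_singleton, range_zero, prod_empty,
      Function.iterate_zero, id]
    split_ifs with h
    · rw [h]
      convert (Matrix.det_one (n := Fin b) (R := ℤ)).symm using 2
      ext i j
      simp [packedState, Matrix.one_apply, Pi.single_apply, Fin.ext_iff]
    · symm
      -- Either some row is zero, or x = 2σ with σ a strictly monotone self-map of `Fin b`, hence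
      -- the identity.
      by_cases hr : ∀ i, ∃ j : Fin b, x i = 2 * ((j : ℕ) : ℤ)
      · exfalso
        choose σ hσ using hr
        have hmono : StrictMono σ := by
          intro i j hij
          have := hx hij
          rw [hσ, hσ] at this
          rw [Fin.lt_def]
          omega
        apply h
        ext i
        rw [hσ, hmono.eq_id]
        rfl
      · push Not at hr
        obtain ⟨i, hi⟩ := hr
        exact Matrix.det_eq_zero_of_row_eq_zero i fun j => by
          simp [hi j]
  | succ m ih =>
    have hstep : ∀ y ∈ nextStates x, (∏ t, heightSign (y t)) * signedChainSum m y =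
        (∏ t, heightSign (y t)) * (Matrix.of fun i j : Fin b =>
          transfer^[m] (Pi.single (2 * ((j : ℕ) : ℤ)) 1) (y i)).det := by
      intro y hy
      obtain ⟨h1, h2, h3⟩ := mem_nextStates.1 hy
      rw [ih h2 h3]
      intro t
      have := hpar t
      have := h1 t
      push_cast at *
      omega
    rw [signedChainSum_succ, sum_congr rfl hstep, nextStates, sum_filter_of_ne]
    · rw [sum_piFinset_prod_mul_det _ heightSign
        (fun j => transfer^[m] (Pi.single (2 * ((j : ℕ) : ℤ)) 1))]
      congr 1
      ext i j
      rw [Matrix.of_apply, Matrix.of_apply, sum_pair (by omega), Function.iterate_succ_apply',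
        transfer, if_neg (by have := h0 i; omega)]
    · intro y hy hne
      have hy' : ∀ t, y t = x t - 1 ∨ y t = x t + 1 := by simpa using hy
      have hdet := right_ne_zero_of_mul hne
      constructor
      · intro i j hij
        by_contra! hle
        apply hdet
        refine Matrix.det_zero_of_row_eq hij.ne ?_
        -- All heights have the same parity, so a single step can break strict order only by a
        -- collision.
        have : y i = y j := by
          have := hx hij
          have := hpar i
          have := hpar j
          have := hy' i
          have := hy' j
          omega
        ext l
        rw [Matrix.of_apply, Matrix.of_apply, this]
      · intro t
        by_contra! hlt
        exact hdet (Matrix.det_eq_zero_of_row_eq_zero t fun j =>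
          transfer_iterate_single_neg m j hlt)

theorem heightSign_two_mul (i : ℕ) : heightSign (2 * i) = (-1) ^ i := by
  rw [heightSign, Int.mul_ediv_cancel_left _ (by norm_num), Int.negOnePow_def]
  simp

theorem heightSign_two_mul_add_one (i : ℕ) : heightSign (2 * i + 1) = (-1) ^ i := by
  rw [heightSign, show (2 * (i : ℤ) + 1) / 2 = i by omega, Int.negOnePow_def]
  simp

/-- The excursions from 2i through 2i - 1 and 2i + 1 have opposite signs and cancel. At i = 0 only
the upper one exists, whence the corner entry 1. -/
theorem transfer_transfer (φ : ℤ → ℤ) :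
    (fun i : ℕ => transfer^[2] φ (2 * i)) = jacobi (-1) (Pi.single 0 1) fun i => φ (2 * i) := by
  ext i
  simp only [Function.iterate_succ_apply, Function.iterate_zero, id]
  have h0 := heightSign_two_mul i
  have h1 := heightSign_two_mul_add_one i
  have h2 := heightSign_two_mul (i + 1)
  push_cast at h2
  rw [transfer, if_neg (by omega), transfer, transfer, if_neg (by omega : ¬ (2 * (i : ℤ) + 1 < 0))]
  rcases i with _ | i
  · simp at h0 h1 h2 ⊢
    simp [h0, h1, h2]
  · have h3 := heightSign_two_mul i
    have h4 := heightSign_two_mul_add_one i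
    rw [if_neg (by push_cast; omega), jacobi_apply_succ]
    push_cast at *
    rw [show 2 * ((i : ℤ) + 1) - 1 - 1 = 2 * i by ring,
      show 2 * ((i : ℤ) + 1) - 1 + 1 = 2 * (i + 1) by ring,
      show 2 * ((i : ℤ) + 1) - 1 = 2 * i + 1 by ring,
      show 2 * ((i : ℤ) + 1) + 1 - 1 = 2 * (i + 1) by ring,
      show 2 * ((i : ℤ) + 1) + 1 + 1 = 2 * (i + 1 + 1) by ring,
      show 2 * ((i : ℤ) + 2) = 2 * (i + 1 + 1) by ring, h0, h1, h2, h3, h4]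
    have hs' : ((-1 : ℤ) ^ i) * (-1) ^ i = 1 := by rw [← mul_pow]; simp
    simp only [pow_succ, Pi.single_apply]
    simp
    linear_combination (φ (2 * i) - φ (2 * (i + 1 + 1))) * hs'

theorem transfer_iterate_two_mul (a : ℕ) (φ : ℤ → ℤ) :
    (fun i : ℕ => transfer^[2 * a] φ (2 * i)) =
      (jacobi (-1) (Pi.single 0 1) ^ a) fun i => φ (2 * i) := by
  have h : Function.Semiconj (fun (φ : ℤ → ℤ) (i : ℕ) => φ (2 * i)) transfer^[2]
      (jacobi (-1) (Pi.single 0 1)) := transfer_transfer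
  rw [Module.End.pow_apply, Function.iterate_mul]
  exact (h.iterate_right a).eq φ

theorem signedChainSum_packedState (a b : ℕ) :
    signedChainSum (2 * a) (packedState b) = (∏ i : Fin b, (-1) ^ (i : ℕ)) *
      hankelDet (moment (-1) (Pi.single 0 1)) a b := by
  rw [signedChainSum_eq_det, hankelDet, ← det_jacobi_pow, ← mul_assoc, ← prod_mul_distrib]
  · simp only [← mul_pow, neg_mul_neg, one_mul, one_pow, prod_const_one]
    congr 1
    ext i j
    rw [Matrix.of_apply, Matrix.of_apply, packedState]
    have h := congrFun (transfer_iterate_two_mul a (Pi.single (2 * ((j : ℕ) : ℤ)) 1)) i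
    refine h.trans ?_
    refine congrArg (fun ψ => (jacobi (-1) (Pi.single 0 1) ^ a) ψ i) (funext fun l => ?_)
    simp [Pi.single_apply]
  · intro i j hij
    rw [Fin.lt_def] at hij
    simp only [packedState]
    omega
  · intro t
    simp only [packedState]
    omega
  · intro t
    simp only [packedState]
    push_cast
    omega

end nonintersecting

/-! ### Plane partitions as families of paths. -/

theorem mem_tcPlanePartitions {a c : ℕ} {P : Finset (ℕ × ℕ × ℕ)} :
    P ∈ tcPlanePartitions a c ↔
      P ⊆ box a a c ∧ IsPlanePartition P ∧ IsTransposeComplementary a c P := by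
  simp [tcPlanePartitions]

theorem mem_box {a b c i j k : ℕ} : (i, j, k) ∈ box a b c ↔
    (1 ≤ i ∧ i ≤ a) ∧ (1 ≤ j ∧ j ≤ b) ∧ 1 ≤ k ∧ k ≤ c := by
  simp [_root_.box]

/-- The number of cubes at height `k` of `P` on the diagonal `j - i = s - a`. -/
def diagCount (a : ℕ) (P : Finset (ℕ × ℕ × ℕ)) (s k : ℕ) : ℕ :=
  #{r ∈ Icc 1 a | (r + (a - s), r + (s - a), k) ∈ P}

section diagCount

variable {a c : ℕ} {P : Finset (ℕ × ℕ × ℕ)}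

/-- Points on a diagonal, numbered by r = min(i, j), belong to `P` along an initial segment.
Truncated subtraction makes one of the two offsets zero. -/
theorem mem_iff_le_diagCount (hbox : P ⊆ box a a c) (hP : IsPlanePartition P) {s k r : ℕ}
    (hr : 1 ≤ r) : (r + (a - s), r + (s - a), k) ∈ P ↔ r ≤ diagCount a P s k := by
  have hdown : ∀ r r', 1 ≤ r' → r' ≤ r → (r + (a - s), r + (s - a), k) ∈ P →
      (r' + (a - s), r' + (s - a), k) ∈ P := by
    intro r r' h1 h2 h
    have h3 := hP.1 _ _ _ h
    exact hP.2 _ _ _ _ _ _ h (by omega) (by omega) (by omega) (by omega) h3.2.2 le_rfl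
  constructor
  · intro h
    have h3 := mem_box.1 (hbox h)
    have hsub : Icc 1 r ⊆ {r ∈ Icc 1 a | (r + (a - s), r + (s - a), k) ∈ P} := by
      intro x hx
      rw [mem_Icc] at hx
      rw [mem_filter, mem_Icc]
      exact ⟨by omega, hdown r x hx.1 hx.2 h⟩
    simpa [diagCount] using card_le_card hsub
  · intro h
    by_contra hn
    have hsub : {r ∈ Icc 1 a | (r + (a - s), r + (s - a), k) ∈ P} ⊆ Icc 1 (r - 1) := by
      intro x hx
      rw [mem_filter, mem_Icc] at hx
      rw [mem_Icc]
      refine ⟨hx.1.1, ?_⟩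
      by_contra hlt
      exact hn (hdown x r hr (by omega) hx.2)
    have := card_le_card hsub
    rw [Nat.card_Icc] at this
    unfold diagCount at h
    omega

theorem diagCount_eq_of_forall (hbox : P ⊆ box a a c) (hP : IsPlanePartition P) {s k n : ℕ}
    (h : ∀ r, 1 ≤ r → ((r + (a - s), r + (s - a), k) ∈ P ↔ r ≤ n)) : diagCount a P s k = n := by
  apply le_antisymm
  · by_contra! hlt
    have := (h _ (by omega)).1 ((mem_iff_le_diagCount hbox hP (by omega)).2 le_rfl)
    omega
  · by_contra! hlt
    have := (mem_iff_le_diagCount hbox hP (by omega)).1 ((h n (by omega)).2 le_rfl)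
    omega

theorem le_diagCount_of_le (hbox : P ⊆ box a a c) (hP : IsPlanePartition P) {s s' k k' r r' : ℕ}
    (hr' : 1 ≤ r') (h1 : r' + (a - s') ≤ r + (a - s)) (h2 : r' + (s' - a) ≤ r + (s - a))
    (hk' : 1 ≤ k') (hk : k' ≤ k) (hr : 1 ≤ r) (h : r ≤ diagCount a P s k) :
    r' ≤ diagCount a P s' k' := by
  rw [← mem_iff_le_diagCount hbox hP hr] at h
  rw [← mem_iff_le_diagCount hbox hP hr']
  exact hP.2 _ _ _ _ _ _ h (by omega) h1 (by omega) h2 hk' hk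

end diagCount

/-- Otherwise the complementary point lies componentwise below the given one, so both would belong
to `P`. -/
theorem add_le_of_mem_upper {a b i j k : ℕ} {P : Finset (ℕ × ℕ × ℕ)}
    (h : P ∈ tcPlanePartitions a (2 * b)) (hmem : (i, j, k) ∈ P) (hk : b < k) : i + j ≤ a := by
  obtain ⟨hbox, hP, htc⟩ := mem_tcPlanePartitions.1 h
  have hb := mem_box.1 (hbox hmem)
  by_contra! hlt
  refine (htc i (mem_Icc.2 hb.1) j (mem_Icc.2 hb.2.1) k (mem_Icc.2 hb.2.2)).1 hmem ?_
  exact hP.2 _ _ _ _ _ _ hmem (by omega) (by omega) (by omega) (by omega) (by omega) (by omega)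

/-- The r-th point of the diagonal has i + j = 2r + |a - s|. The bound keeps the paths nonnegative
and fixes their endpoints. -/
theorem two_mul_diagCount_le {a b s k : ℕ} {P : Finset (ℕ × ℕ × ℕ)}
    (h : P ∈ tcPlanePartitions a (2 * b)) (hk : b < k) (hs : s ≤ 2 * a) :
    2 * diagCount a P s k + (a - s) + (s - a) ≤ a := by
  obtain ⟨hbox, hP, htc⟩ := mem_tcPlanePartitions.1 h
  rcases Nat.eq_zero_or_pos (diagCount a P s k) with h0 | h0
  · omega
  · have := add_le_of_mem_upper h ((mem_iff_le_diagCount hbox hP h0).2 le_rfl) hk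
    omega

/-- The family of nonintersecting paths associated with a plane partition. -/
def chainOfPartition (a b : ℕ) (P : Finset (ℕ × ℕ × ℕ)) (s : ℕ) (t : Fin b) : ℤ :=
  a - ((a - min s (2 * a) : ℕ) + (min s (2 * a) - a : ℕ))
    - 2 * diagCount a P (min s (2 * a)) (b + 1 + t) + 2 * (t : ℕ)

/-- The plane partition associated with a family of nonintersecting paths. -/
def partitionOfChain {b : ℕ} (a : ℕ) (f : ℕ → Fin b → ℤ) : Finset (ℕ × ℕ × ℕ) :=
  {p ∈ box a a (2 * b) | ∃ t : Fin b,
    (p.2.2 = b + 1 + t ∧ f (a + p.2.1 - p.1) t - 2 * (t : ℕ) + p.1 + p.2.1 ≤ a) ∨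
    (p.2.2 + t = b ∧ (p.1 : ℤ) + p.2.1 < f (a + p.2.1 - p.1) t - 2 * (t : ℕ) + a + 2)}

theorem mem_partitionOfChain_upper {a b i j : ℕ} {f : ℕ → Fin b → ℤ} {t : Fin b} :
    (i, j, b + 1 + (t : ℕ)) ∈ partitionOfChain a f ↔ ((1 ≤ i ∧ i ≤ a) ∧ (1 ≤ j ∧ j ≤ a)) ∧
      f (a + j - i) t - 2 * (t : ℕ) + i + j ≤ a := by
  rw [partitionOfChain, mem_filter, mem_box]
  constructor
  · rintro ⟨h, t', ⟨h1, h2⟩ | ⟨h1, h2⟩⟩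
    · obtain rfl : t = t' := by ext; simpa using h1
      exact ⟨⟨h.1, h.2.1⟩, h2⟩
    · simp only at h1
      omega
  · rintro ⟨h, h2⟩
    exact ⟨⟨h.1, h.2, by omega, by omega⟩, t, Or.inl ⟨rfl, h2⟩⟩

theorem mem_partitionOfChain_lower {a b i j k : ℕ} {f : ℕ → Fin b → ℤ} {t : Fin b}
    (hk : k + t = b) :
    (i, j, k) ∈ partitionOfChain a f ↔ ((1 ≤ i ∧ i ≤ a) ∧ (1 ≤ j ∧ j ≤ a)) ∧
      (i : ℤ) + j < f (a + j - i) t - 2 * (t : ℕ) + a + 2 := by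
  rw [partitionOfChain, mem_filter, mem_box]
  constructor
  · rintro ⟨h, t', ⟨h1, h2⟩ | ⟨h1, h2⟩⟩
    · simp only at h1
      omega
    · obtain rfl : t = t' := by ext; simp only at h1; omega
      exact ⟨⟨h.1, h.2.1⟩, h2⟩
  · rintro ⟨h, h2⟩
    exact ⟨⟨h.1, h.2, by omega, by omega⟩, t, Or.inr ⟨hk, h2⟩⟩

theorem exists_fin_height {b k : ℕ} (h1 : 1 ≤ k) (h2 : k ≤ 2 * b) :
    (∃ t : Fin b, k = b + 1 + t) ∨ ∃ t : Fin b, k + t = b := by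
  by_cases h : b < k
  · exact Or.inl ⟨⟨k - b - 1, by omega⟩, by simp only; omega⟩
  · exact Or.inr ⟨⟨b - k, by omega⟩, by simp only; omega⟩

theorem isTransposeComplementary_partitionOfChain {b : ℕ} (a : ℕ) (f : ℕ → Fin b → ℤ) :
    IsTransposeComplementary a (2 * b) (partitionOfChain a f) := by
  intro i hi j hj k hk
  rw [mem_Icc] at hi hj hk
  have hs : a + (a + 1 - i) - (a + 1 - j) = a + j - i := by omega
  rcases exists_fin_height hk.1 hk.2 with ⟨t, rfl⟩ | ⟨t, ht⟩
  · rw [mem_partitionOfChain_upper,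
      mem_partitionOfChain_lower (t := t) (by omega : 2 * b + 1 - (b + 1 + t) + t = b), hs]
    push_cast [Nat.cast_sub (by omega : i ≤ a + 1), Nat.cast_sub (by omega : j ≤ a + 1)]
    constructor
    · rintro ⟨-, h⟩ ⟨-, h'⟩
      omega
    · intro h
      refine ⟨⟨hi, hj⟩, ?_⟩
      by_contra! hlt
      exact h ⟨by omega, by omega⟩
  · rw [mem_partitionOfChain_lower ht, show 2 * b + 1 - k = b + 1 + t by omega,
      mem_partitionOfChain_upper, hs]
    push_cast [Nat.cast_sub (by omega : i ≤ a + 1), Nat.cast_sub (by omega : j ≤ a + 1)]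
    constructor
    · rintro ⟨-, h⟩ ⟨-, h'⟩
      omega
    · intro h
      refine ⟨⟨hi, hj⟩, ?_⟩
      by_contra! hlt
      exact h ⟨by omega, by omega⟩

theorem IsTransposeComplementary.ext {a b : ℕ} {P Q : Finset (ℕ × ℕ × ℕ)}
    (hP : IsTransposeComplementary a (2 * b) P) (hQ : IsTransposeComplementary a (2 * b) Q)
    (hPbox : P ⊆ box a a (2 * b)) (hQbox : Q ⊆ box a a (2 * b))
    (h : ∀ i ∈ Icc 1 a, ∀ j ∈ Icc 1 a, ∀ t : Fin b, (i, j, b + 1 + (t : ℕ)) ∈ P ↔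
      (i, j, b + 1 + (t : ℕ)) ∈ Q) : P = Q := by
  have key : ∀ p ∈ box a a (2 * b), p ∈ P ↔ p ∈ Q := by
    rintro ⟨i, j, k⟩ hp
    obtain ⟨hi, hj, hk⟩ := mem_box.1 hp
    rcases exists_fin_height hk.1 hk.2 with ⟨t, rfl⟩ | ⟨t, ht⟩
    · exact h i (mem_Icc.2 hi) j (mem_Icc.2 hj) t
    · rw [hP i (mem_Icc.2 hi) j (mem_Icc.2 hj) k (mem_Icc.2 hk),
        hQ i (mem_Icc.2 hi) j (mem_Icc.2 hj) k (mem_Icc.2 hk),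
        show 2 * b + 1 - k = b + 1 + t by omega,
        h _ (mem_Icc.2 (by omega)) _ (mem_Icc.2 (by omega))]
  ext p
  exact ⟨fun hp => (key p (hPbox hp)).1 hp, fun hp => (key p (hQbox hp)).2 hp⟩

theorem partitionOfChain_subset_box {b : ℕ} (a : ℕ) (f : ℕ → Fin b → ℤ) :
    partitionOfChain a f ⊆ box a a (2 * b) := filter_subset _ _

theorem partitionOfChain_chainOfPartition {a b : ℕ} {P : Finset (ℕ × ℕ × ℕ)}
    (h : P ∈ tcPlanePartitions a (2 * b)) : partitionOfChain a (chainOfPartition a b P) = P := by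
  obtain ⟨hbox, hP, htc⟩ := mem_tcPlanePartitions.1 h
  refine IsTransposeComplementary.ext (isTransposeComplementary_partitionOfChain a _) htc
    (partitionOfChain_subset_box a _) hbox fun i hi j hj t => ?_
  rw [mem_Icc] at hi hj
  rw [mem_partitionOfChain_upper, and_iff_right ⟨hi, hj⟩, chainOfPartition,
    min_eq_left (by omega : a + j - i ≤ 2 * a)]
  have hmem := mem_iff_le_diagCount hbox hP (s := a + j - i) (k := b + 1 + t)
    (by omega : 1 ≤ min i j)
  rw [show min i j + (a - (a + j - i)) = i by omega,
    show min i j + (a + j - i - a) = j by omega] at hmem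
  rw [hmem]
  omega

/-- Counts on neighbouring diagonals interlace, which gives ±1 steps; counts decrease weakly with
the layer, so the shift 2t makes heights strictly increasing. -/
theorem chainOfPartition_mem_chains {a b : ℕ} {P : Finset (ℕ × ℕ × ℕ)}
    (h : P ∈ tcPlanePartitions a (2 * b)) :
    chainOfPartition a b P ∈ {f ∈ chains nextStates (2 * a) (packedState b) |
      f (2 * a) = packedState b} := by
  obtain ⟨hbox, hP, htc⟩ := mem_tcPlanePartitions.1 h
  rw [mem_filter, mem_chains]
  refine ⟨⟨?_, fun s hs => ?_, fun s hs => ?_⟩, ?_⟩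
  · ext t
    have := two_mul_diagCount_le h (by omega : b < b + 1 + t) (by omega : min 0 (2 * a) ≤ 2 * a)
    simp only [chainOfPartition, packedState]
    omega
  · rw [mem_nextStates]
    have e0 : min s (2 * a) = s := by omega
    have e1 : min (s + 1) (2 * a) = s + 1 := by omega
    simp only [chainOfPartition, e0, e1]
    refine ⟨fun t => ?_, fun t t' htt => ?_, fun t => ?_⟩
    · generalize hk : b + 1 + (t : ℕ) = k
      have hle := fun r r' => le_diagCount_of_le hbox hP (s := s) (s' := s + 1) (k := k) (k' := k)
        (r := r) (r' := r')
      have hle' := fun r r' => le_diagCount_of_le hbox hP (s := s + 1) (s' := s) (k := k) (k' := k)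
        (r := r) (r' := r')
      by_cases hsa : a ≤ s
      · have h1 : diagCount a P (s + 1) k ≤ diagCount a P s k := by
          by_contra! hlt
          have := hle' _ (diagCount a P (s + 1) k) (by omega) (by omega) (by omega) (by omega)
            le_rfl (by omega) le_rfl
          omega
        have h2 : diagCount a P s k ≤ diagCount a P (s + 1) k + 1 := by
          by_contra! hlt
          have := hle _ (diagCount a P s k - 1) (by omega) (by omega) (by omega) (by omega)
            le_rfl (by omega) le_rfl
          omega
        omega
      · have h1 : diagCount a P s k ≤ diagCount a P (s + 1) k := by
          by_contra! hlt
          have := hle _ (diagCount a P s k) (by omega) (by omega) (by omega) (by omega)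
            le_rfl (by omega) le_rfl
          omega
        have h2 : diagCount a P (s + 1) k ≤ diagCount a P s k + 1 := by
          by_contra! hlt
          have := hle' _ (diagCount a P (s + 1) k - 1) (by omega) (by omega) (by omega) (by omega)
            le_rfl (by omega) le_rfl
          omega
        omega
    · rw [Fin.lt_def] at htt
      have : diagCount a P (s + 1) (b + 1 + t') ≤ diagCount a P (s + 1) (b + 1 + t) := by
        by_contra! hlt
        have := le_diagCount_of_le hbox hP (s := s + 1) (s' := s + 1) (k := b + 1 + t')
          (k' := b + 1 + t) (r := diagCount a P (s + 1) (b + 1 + t')) (by omega) le_rfl le_rfl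
          (by omega) (by omega) (by omega) le_rfl
        omega
      simp only [chainOfPartition, e1]
      omega
    · have := two_mul_diagCount_le h (by omega : b < b + 1 + t) (by omega : s + 1 ≤ 2 * a)
      omega
  · ext t
    simp only [chainOfPartition, min_eq_right hs, min_self]
  · ext t
    have := two_mul_diagCount_le h (by omega : b < b + 1 + t) (by omega : 2 * a ≤ 2 * a)
    simp only [chainOfPartition, packedState, min_self]
    omega

section chain

variable {a b : ℕ} {f : ℕ → Fin b → ℤ}

theorem chain_basic (hf : f ∈ chains nextStates (2 * a) (packedState b)) {s : ℕ}
    (hs : s ≤ 2 * a) : StrictMono (f s) ∧ (∀ t, 0 ≤ f s t) ∧ ∀ t, f s t % 2 = s % 2 := by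
  obtain ⟨h0, h1, -⟩ := mem_chains.1 hf
  induction s with
  | zero =>
    rw [h0]
    refine ⟨fun t t' h => ?_, fun t => ?_, fun t => ?_⟩
    · rw [Fin.lt_def] at h
      simp only [packedState]
      omega
    · simp only [packedState]
      omega
    · simp [packedState]
  | succ s ih =>
    obtain ⟨h2, h3, h4⟩ := mem_nextStates.1 (h1 s (by omega))
    refine ⟨h3, h4, fun t => ?_⟩
    have h5 := (ih (by omega)).2.2 t
    have h6 := h2 t
    push_cast
    omega

/-- Distinct heights of equal parity differ by at least 2. -/
theorem chain_gap (hf : f ∈ chains nextStates (2 * a) (packedState b)) {s : ℕ}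
    (hs : s ≤ 2 * a) {t t' : Fin b} (h : t ≤ t') :
    f s t - 2 * (t : ℕ) ≤ f s t' - 2 * (t' : ℕ) := by
  obtain ⟨h1, -, h3⟩ := chain_basic hf hs
  obtain ⟨t', ht'⟩ := t'
  have hle : (t : ℕ) ≤ t' := h
  induction t', hle using Nat.le_induction with
  | base => exact le_rfl
  | succ n hn ih =>
    have h4 := ih (by omega) hn
    have h5 : f s ⟨n, by omega⟩ < f s ⟨n + 1, ht'⟩ := h1 (by simp [Fin.lt_def])
    have h6 := h3 ⟨n, by omega⟩
    have h7 := h3 ⟨n + 1, ht'⟩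
    push_cast at *
    omega

theorem chain_two_mul_le (hf : f ∈ chains nextStates (2 * a) (packedState b)) {s : ℕ}
    (hs : s ≤ 2 * a) (t : Fin b) : 2 * ((t : ℕ) : ℤ) ≤ f s t := by
  have hb := t.2
  have h1 := chain_gap hf hs (t := ⟨0, by omega⟩) (t' := t) (by simp [Fin.le_def])
  have h2 := (chain_basic hf hs).2.1 ⟨0, by omega⟩
  push_cast at h1
  omega

theorem chain_lipschitz (hf : f ∈ chains nextStates (2 * a) (packedState b)) {s s' : ℕ}
    (hss : s ≤ s') (hs' : s' ≤ 2 * a) (t : Fin b) :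
    f s t - f s' t ≤ s' - s ∧ f s' t - f s t ≤ s' - s := by
  obtain ⟨-, h1, -⟩ := mem_chains.1 hf
  induction s', hss using Nat.le_induction with
  | base => simp
  | succ n hn ih =>
    have h2 := ih (by omega)
    have h3 := (mem_nextStates.1 (h1 n (by omega))).1 t
    push_cast
    omega

theorem chain_sub_le (hf : f ∈ chains nextStates (2 * a) (packedState b)) {s s' : ℕ}
    (hs : s ≤ 2 * a) (hs' : s' ≤ 2 * a) (t : Fin b) : f s t - f s' t ≤ |(s : ℤ) - s'| := by
  rcases le_total s s' with h | h
  · have := chain_lipschitz hf h hs' t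
    rw [abs_of_nonpos (by omega)]
    omega
  · have := chain_lipschitz hf h hs t
    rw [abs_of_nonneg (by omega)]
    omega

/-- Within a half, the Lipschitz bound compares diagonals and `chain_gap` compares layers. Across
the middle, f - 2t ≥ 0 suffices: upper cubes have i + j ≤ a, and lower layers contain all points
with i + j < a + 2. -/
theorem isPlanePartition_partitionOfChain
    (hf : f ∈ chains nextStates (2 * a) (packedState b)) :
    IsPlanePartition (partitionOfChain a f) := by
  refine ⟨fun i j k h => ?_, fun i j k i' j' k' h hi' hi hj' hj hk' hk => ?_⟩
  · have := mem_box.1 (partitionOfChain_subset_box a f h)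
    omega
  · have hb := mem_box.1 (partitionOfChain_subset_box a f h)
    have hs : a + j - i ≤ 2 * a := by omega
    have hs' : a + j' - i' ≤ 2 * a := by omega
    have habs : |((a + j' - i' : ℕ) : ℤ) - (a + j - i : ℕ)| ≤ ((i : ℤ) - i') + (j - j') := by
      rw [abs_le]
      omega
    have habs' := abs_sub_comm (((a + j' - i' : ℕ) : ℤ)) ((a + j - i : ℕ) : ℤ)
    rcases exists_fin_height hb.2.2.1 hb.2.2.2 with ⟨t, rfl⟩ | ⟨t, ht⟩
    · obtain ⟨-, h1⟩ := mem_partitionOfChain_upper.1 h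
      rcases exists_fin_height (b := b) hk' (by omega) with ⟨t', rfl⟩ | ⟨t', ht'⟩
      · refine mem_partitionOfChain_upper.2 ⟨by omega, ?_⟩
        have h2 := chain_gap hf hs' (t := t') (t' := t) (Fin.le_def.2 (by omega))
        have h3 := chain_sub_le hf hs' hs t
        omega
      · refine (mem_partitionOfChain_lower ht').2 ⟨by omega, ?_⟩
        have h2 := chain_two_mul_le hf hs' t'
        have h3 := chain_two_mul_le hf hs t
        omega
    · obtain ⟨-, h1⟩ := (mem_partitionOfChain_lower ht).1 h
      rcases exists_fin_height (b := b) hk' (by omega) with ⟨t', rfl⟩ | ⟨t', ht'⟩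
      · omega
      · refine (mem_partitionOfChain_lower ht').2 ⟨by omega, ?_⟩
        have h2 := chain_gap hf hs' (t := t) (t' := t') (Fin.le_def.2 (by omega))
        have h3 := chain_sub_le hf hs hs' t
        omega

theorem partitionOfChain_mem (hf : f ∈ chains nextStates (2 * a) (packedState b)) :
    partitionOfChain a f ∈ tcPlanePartitions a (2 * b) :=
  mem_tcPlanePartitions.2 ⟨partitionOfChain_subset_box a f, isPlanePartition_partitionOfChain hf,
    isTransposeComplementary_partitionOfChain a f⟩

theorem chainOfPartition_partitionOfChain
    (hf : f ∈ chains nextStates (2 * a) (packedState b)) (hend : f (2 * a) = packedState b) :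
    chainOfPartition a b (partitionOfChain a f) = f := by
  obtain ⟨h0, -, hconst⟩ := mem_chains.1 hf
  ext s t
  obtain ⟨s', hs', hmin, hfs⟩ : ∃ s', s' ≤ 2 * a ∧ min s (2 * a) = s' ∧ f s = f s' := by
    refine ⟨_, min_le_right _ _, rfl, ?_⟩
    rcases le_total s (2 * a) with h | h
    · rw [min_eq_left h]
    · rw [min_eq_right h, hconst s h]
  have h1 := chain_two_mul_le hf hs' t
  -- The bounds from both endpoints give f - 2t ≤ a - |a - s'|, so `toNat` below does not truncate;
  -- parity makes the halving exact.
  have h2 := (chain_lipschitz hf (Nat.zero_le s') hs' t).2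
  have h3 := (chain_lipschitz hf hs' le_rfl t).1
  have h4 := (chain_basic hf hs').2.2 t
  rw [h0] at h2
  rw [hend] at h3
  simp only [packedState] at h2 h3
  have hcount : diagCount a (partitionOfChain a f) s' (b + 1 + t) =
      ((a - ((a - s' : ℕ) + (s' - a : ℕ)) - (f s' t - 2 * (t : ℕ))) / 2).toNat := by
    refine diagCount_eq_of_forall (partitionOfChain_subset_box a f)
      (isPlanePartition_partitionOfChain hf) fun r hr => ?_
    rw [mem_partitionOfChain_upper, show a + (r + (s' - a)) - (r + (a - s')) = s' by omega]
    omega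
  rw [chainOfPartition, hmin, hcount, hfs]
  omega

end chain

/-! ### Comparison of signs. -/

theorem upperCubes_eq_sum {a b : ℕ} {P : Finset (ℕ × ℕ × ℕ)}
    (h : P ∈ tcPlanePartitions a (2 * b)) :
    upperCubes b P = ∑ s ∈ range (2 * a), ∑ t : Fin b, diagCount a P (s + 1) (b + 1 + t) := by
  obtain ⟨hbox, hP, htc⟩ := mem_tcPlanePartitions.1 h
  have hmaps : ∀ p ∈ P.filter (fun p => b < p.2.2),
      (a + p.2.1 - p.1 - 1, p.2.2 - b - 1) ∈ range (2 * a) ×ˢ range b := by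
    rintro ⟨i, j, k⟩ hp
    rw [mem_filter] at hp
    have := mem_box.1 (hbox hp.1)
    have := hp.2
    rw [mem_product, mem_range, mem_range]
    simp only at *
    omega
  rw [upperCubes, card_eq_sum_card_fiberwise hmaps, sum_product]
  refine sum_congr rfl fun s hs => ?_
  rw [Fin.sum_univ_eq_sum_range fun t => diagCount a P (s + 1) (b + 1 + t)]
  refine sum_congr rfl fun t ht => ?_
  rw [mem_range] at hs ht
  rw [diagCount]
  refine card_nbij' (fun p => min p.1 p.2.1)
    (fun r => (r + (a - (s + 1)), r + (s + 1 - a), b + 1 + t)) ?_ ?_ ?_ ?_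
  · rintro ⟨i, j, k⟩ hp
    simp only [coe_filter, Set.mem_ofPred_eq, mem_filter, Prod.mk.injEq] at hp
    have := mem_box.1 (hbox hp.1.1)
    simp only [coe_filter, Set.mem_ofPred_eq, mem_Icc]
    rw [show min i j + (a - (s + 1)) = i by omega, show min i j + (s + 1 - a) = j by omega,
      show b + 1 + t = k by omega]
    exact ⟨by omega, hp.1.1⟩
  · intro r hr
    simp only [coe_filter, Set.mem_ofPred_eq, mem_Icc] at hr
    simp only [coe_filter, Set.mem_ofPred_eq, mem_filter, Prod.mk.injEq]
    exact ⟨⟨hr.2, by omega⟩, by omega, by omega⟩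
  · rintro ⟨i, j, k⟩ hp
    simp only [coe_filter, Set.mem_ofPred_eq, mem_filter, Prod.mk.injEq] at hp
    have := mem_box.1 (hbox hp.1.1)
    simp only [Prod.mk.injEq]
    omega
  · intro r hr
    simp only
    omega

theorem heightSign_sub_add (h c t : ℕ) :
    heightSign (h - 2 * c + 2 * t) = (-1) ^ (h / 2) * (-1) ^ c * (-1) ^ t := by
  rw [heightSign, show ((h : ℤ) - 2 * c + 2 * t) / 2 = (h / 2 : ℕ) - c + t by omega,
    Int.negOnePow_add, Int.negOnePow_sub]
  simp only [Int.negOnePow_def, zpow_natCast, Units.val_mul, Units.val_pow_eq_pow_val,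
    Units.val_neg, Units.val_one]

/-- Folding the product at its middle pairs exponents ⌊(u+1)/2⌋ and ⌊u/2⌋, whose sum is u; the total
a(a-1)/2 has the parity of ⌊a/2⌋. -/
theorem prod_neg_one_pow_min_half (a : ℕ) :
    ∏ s ∈ range (2 * a), (-1 : ℤ) ^ (min (s + 1) (2 * a - (s + 1)) / 2) = (-1) ^ (a / 2) := by
  rw [two_mul, prod_range_add, ← prod_range_reflect (fun x => (-1 : ℤ) ^ (min (a + x + 1)
    (a + a - (a + x + 1)) / 2)), ← prod_mul_distrib]
  have hstep : ∀ u ∈ range a, (-1 : ℤ) ^ (min (u + 1) (a + a - (u + 1)) / 2) *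
      (-1) ^ (min (a + (a - 1 - u) + 1) (a + a - (a + (a - 1 - u) + 1)) / 2) =
      (-1) ^ ((u + 1) / 2) * (-1) ^ (u / 2) := by
    intro u hu
    rw [mem_range] at hu
    congr 3 <;> omega
  rw [prod_congr rfl hstep]
  clear hstep
  induction a with
  | zero => simp
  | succ a ih =>
    have hs : ((-1 : ℤ) ^ (a / 2)) * (-1) ^ (a / 2) = 1 := by rw [← mul_pow]; simp
    rw [prod_range_succ, ih]
    linear_combination (-1) ^ ((a + 1) / 2) * hs

/-- The sign of a height splits into contributions of the highest path, the cube count and the layer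
shift 2t. The first gives the global sign, and the last cancels over the 2a steps. -/
theorem neg_one_pow_upperCubes {a b : ℕ} {P : Finset (ℕ × ℕ × ℕ)}
    (h : P ∈ tcPlanePartitions a (2 * b)) :
    (-1 : ℤ) ^ upperCubes b P = (-1) ^ (b * (a / 2)) *
      ∏ s ∈ range (2 * a), ∏ t : Fin b, heightSign (chainOfPartition a b P (s + 1) t) := by
  have hsign : ∀ s ∈ range (2 * a), ∏ t : Fin b, heightSign (chainOfPartition a b P (s + 1) t) =
      ((-1) ^ (min (s + 1) (2 * a - (s + 1)) / 2)) ^ b *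
        (-1) ^ (∑ t : Fin b, diagCount a P (s + 1) (b + 1 + t)) * ∏ t : Fin b, (-1) ^ (t : ℕ) := by
    intro s hs
    rw [mem_range] at hs
    rw [← prod_pow_eq_pow_sum]
    have : ∀ t : Fin b, heightSign (chainOfPartition a b P (s + 1) t) =
        (-1) ^ (min (s + 1) (2 * a - (s + 1)) / 2) * (-1) ^ diagCount a P (s + 1) (b + 1 + t) *
          (-1) ^ (t : ℕ) := by
      intro t
      rw [← heightSign_sub_add, chainOfPartition, min_eq_left (by omega : s + 1 ≤ 2 * a)]
      congr 1
      omega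
    simp only [this, prod_mul_distrib, prod_const, card_univ, Fintype.card_fin]
  have hsq : ∀ x : ℕ, ((-1 : ℤ) ^ x) * (-1) ^ x = 1 := fun x => by rw [← mul_pow]; simp
  rw [prod_congr rfl hsign, prod_mul_distrib, prod_mul_distrib, prod_pow,
    prod_neg_one_pow_min_half, prod_pow_eq_pow_sum, ← upperCubes_eq_sum h, prod_const,
    card_range, prod_fin_neg_one_pow, mul_comm b, pow_mul, pow_mul (_ ^ _) 2 a,
    pow_two, hsq, one_pow, mul_one, ← mul_assoc, ← pow_mul, hsq, one_mul]

/-- Transpose-complementary plane partitions correspond to families of nonintersecting paths. -/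
theorem sum_neg_one_pow_upperCubes (a b : ℕ) :
    ∑ P ∈ tcPlanePartitions a (2 * b), (-1 : ℤ) ^ upperCubes b P =
      (-1) ^ (b * (a / 2)) * signedChainSum (2 * a) (packedState b) := by
  rw [signedChainSum, ← sum_filter, mul_sum]
  refine sum_nbij' (chainOfPartition a b) (partitionOfChain a)
    (fun P hP => chainOfPartition_mem_chains hP)
    (fun f hf => partitionOfChain_mem (mem_filter.1 hf).1)
    (fun P hP => partitionOfChain_chainOfPartition hP)
    (fun f hf => chainOfPartition_partitionOfChain (mem_filter.1 hf).1 (mem_filter.1 hf).2)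
    fun P hP => neg_one_pow_upperCubes hP

theorem theorem1 (a b : ℕ) (ha : 1 ≤ a) :
    ((∑ P ∈ tcPlanePartitions a (2 * b), (-1 : ℤ) ^ upperCubes b P : ℤ) : ℚ) =
      if Odd b ∧ Even a then 0
      else ∏ j ∈ Icc 1 (⌈(a : ℚ) / 2⌉₊ - 1),
        ((⌊(b : ℚ) / 2⌋₊ : ℚ) + (j : ℚ)) * shiftedFactorial ((a : ℚ) - (j : ℚ)) b
          / shiftedFactorial (j : ℚ) (b + 1) := by
  rw [sum_neg_one_pow_upperCubes, signedChainSum_packedState, sign_mul_hankelDet_moment a b ha]
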